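/- **Definitions.** A *code* of length $N$ is a linear subspace of $\mathbb F_2^N$; its minimum distance is the least Hamming distance between two distinct codewords. A $(c,d,\alpha,\delta)$-*bipartite expander* is a (simple) bipartite graph $G=(L\cup R,E)$ in which every $u\in L$ has degree $c$, every $v\in R$ has degree $d$, and $|N(S)|\ge \delta c|S|$ for every $S\subseteq L$ with $|S|\le\alpha|L|$. If $L=[n]$, $C_0\subseteq\mathbb F_2^d$ is a code, and for every $v\in R$ a total ordering $N(v,1),\dots,N(v,d)$ of the neighbourhood $N(v)$ is fixed, the *Tanner code* is $$T(G,C_0)=\{x\in\mathbb F_2^n:\ (x_{N(v,1)},\dots,x_{N(v,d)})\in C_0\text{ for all }v\in R\}.$$ For $k>1$, the *Size-Expansion Function* $f_\delta(k)$ is the optimal value (infimum) of the linear program $$\text{minimize } \frac1k\sum_{i=1}^\infty\beta_i\quad\text{subject to}\quad \sum_{i=1}^\infty i\beta_i=k,\quad \sum_{i=1}^\infty\Bigl(1-\bigl(1-\tfrac1k\bigr)^i\Bigr)\beta_i\ge\delta,\quad \beta_i\ge0\ (i\ge1).$$ **Theorem.** Let $\delta\in(0,1)$, let $d_0$ be a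 positive integer with $\delta d_0>1$, and let $\epsilon>0$. Then there is exactly one $k>1$ with $f_\delta(k)=1/d_0$; write $f_\delta^{-1}(1/d_0)$ for it. For every integer $d\ge d_0$ there exist a positive integer $c$ and a real $\alpha\in(0,1]$ such that for infinitely many $n$ there is a $(c,d,\alpha,\delta-\epsilon)$-bipartite expander $G$ with left vertex set $[n]$ with the following property: for every linear code $C_0\subseteq\mathbb F_2^d$ of minimum distance $d_0$, there is a choice of a total ordering on $N(v)$ for each right vertex $v$ such that the Tanner code $T(G,C_0)$ is not $\{0\}$ and has minimum distance at most $f_\delta^{-1}(1/d_0)\,\alpha n$. -/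

import Mathlib

namespace TannerExpander

noncomputable section

/- The minimum distance of a binary linear code, the least Hamming distance of two distinct
codewords; a code without two distinct codewords gets the value `⊤`. -/
def minDist {ι : Type*} [Fintype ι] (C : Submodule (ZMod 2) (ι → ZMod 2)) : ℕ∞ :=
  ⨅ (x ∈ C) (y ∈ C) (_ : x ≠ y), (hammingDist x y : ℕ∞)

/- A bipartite graph with left part `L` and right part `R` is given by its set of edges
`E ⊆ L × R` (no multiple edges). -/
section Graph

variable {L R : Type*} [Fintype L] [Fintype R] [DecidableEq L] [DecidableEq R]

/- The neighbours of a left vertex. -/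
def leftNbrs (E : Finset (L × R)) (u : L) : Finset R :=
  Finset.univ.filter fun v => (u, v) ∈ E

/- The neighbours of a right vertex. -/
def rightNbrs (E : Finset (L × R)) (v : R) : Finset L :=
  Finset.univ.filter fun u => (u, v) ∈ E

/- The neighbourhood `N(S)` of a set `S` of left vertices. -/
def nbrs (E : Finset (L × R)) (S : Finset L) : Finset R :=
  Finset.univ.filter fun v => ∃ u ∈ S, (u, v) ∈ E

/- `(c, d, α, δ)`-bipartite expanders. -/
structure IsBipartiteExpander (E : Finset (L × R)) (c d : ℕ) (α δ : ℝ) : Prop where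
  left_regular : ∀ u : L, (leftNbrs E u).card = c
  right_regular : ∀ v : R, (rightNbrs E v).card = d
  expansion : ∀ S : Finset L, (S.card : ℝ) ≤ α * (Fintype.card L : ℝ) →
    δ * (c : ℝ) * (S.card : ℝ) ≤ ((nbrs E S).card : ℝ)

/- A choice, for each right vertex `v`, of a total ordering of its `d` neighbours:
`σ v i` is the `i`-th element of `N(v)`. -/
abbrev NbrOrdering (E : Finset (L × R)) (d : ℕ) : Type _ :=
  (v : R) → (Fin d ≃ {u : L // u ∈ rightNbrs E v})

/- The Tanner code `T(G, C₀)`: all words on `L` whose local view at every right vertex, read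
in the chosen ordering, lies in `C₀`. -/
def tannerCode (E : Finset (L × R)) {d : ℕ} (σ : NbrOrdering E d)
    (C₀ : Submodule (ZMod 2) (Fin d → ZMod 2)) : Submodule (ZMod 2) (L → ZMod 2) where
  carrier := {x | ∀ v : R, (fun i : Fin d => x (σ v i)) ∈ C₀}
  add_mem' := fun hx hy v => C₀.add_mem (hx v) (hy v)
  zero_mem' := fun _ => C₀.zero_mem
  smul_mem' := fun a _ hx v => C₀.smul_mem a (hx v)

end Graph

/- The feasible points `β = (β₁, β₂, …)` of the linear program with parameters `δ` and `k`:
`∑ i βᵢ = k`, `∑ (1 - (1 - 1/k)^i) βᵢ ≥ δ` and `βᵢ ≥ 0`. For `k > 1` the coefficients of the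
second series lie in `[0, 1]`, so it converges absolutely because the first series does. -/
def lpFeasible (δ k : ℝ) : Set (ℕ+ → ℝ) :=
  {β | (∀ i, 0 ≤ β i) ∧
    HasSum (fun i : ℕ+ => ((i : ℕ) : ℝ) * β i) k ∧
    δ ≤ ∑' i : ℕ+, (1 - (1 - 1 / k) ^ (i : ℕ)) * β i}

/- The Size-Expansion Function `f_δ(k)` (for `k > 1`, `δ ≤ 1`): the optimal value of the linear
program that minimizes `(1/k) ∑ βᵢ` over the feasible points. -/
def sizeExpansion (δ k : ℝ) : ℝ :=
  sInf ((fun β : ℕ+ → ℝ => 1 / k * ∑' i : ℕ+, β i) '' lpFeasible δ k)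

end

end TannerExpander

/-! The linear program is settled by duality. Put `q = 1 - 1/k`. A supporting line at `n` of the
concave sequence `1 - q ^ i` is a dual solution, and mass on the indices `n` and `n + 1` is a primal
one. Together they show that the optimum is `1/n` exactly when `∑_{j<n} q ^ j = δ n`
(`sizeExpansion_eq_of_sum_eq`, `sum_eq_of_sizeExpansion_eq`). The sum is continuous and, for `n ≥
2`, strictly increasing in `k`, so `k` exists and is unique.

The same sum governs random partitions. A random set of density `τ` in `a` blocks of size `b` meets
about `a (1 - (1 - τ) ^ b) = |T| / b * ∑_{j<b} (1 - τ) ^ j` blocks, at least `δ |T|` when `τ ≤ 1/k`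
and `∑_{j<b} (1 - 1/k) ^ j ≥ δ b`. A Chernoff bound and a union bound over `T` turn this into `c`
partitions that work for all such `T` at once, with any `η < δ` in place of `δ` (`exists_layers`).

The graph contains a set `S` of left vertices, the support of the future codeword, split by `c`
random partitions into blocks of size `d₀`. The expansion threshold `αn` is `|S| / k`, so `S` has
size `k α n`. Filler vertices raise the blocks to size `d`. They lie in `c` copies of a set so large
that the sets considered have tiny density there. Layer `j` takes its fillers from copy `j` only,
which costs each filler at most one of its `c` layers; large `c` hides this loss in `ε`
(`expansion_layerMap`). Each right neighbourhood meets `S` in `d₀` or `0` vertices, so it can be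
ordered to make the indicator of `S` locally a minimum-weight word of `C₀` or zero
(`exists_ordering_minDist_le`). -/

namespace TannerExpander

open Finset

/-! ### Generating functions for blocks met, and the first-moment method. -/

section Counting

/-- The generating function of the subsets of `P × Fin b` by size and by number of blocks met. -/
theorem sum_pow_card_mul_pow_card_image_fst {P : Type*} [Fintype P] [DecidableEq P] (b : ℕ)
    (w z : ℝ) :
    ∑ T : Finset (P × Fin b), w ^ T.card * z ^ (T.image Prod.fst).card =
      (1 + z * ((1 + w) ^ b - 1)) ^ Fintype.card P := by
  classical
  have hin : ∑ F : Finset (Fin b), w ^ F.card * z ^ (if F.Nonempty then 1 else 0) =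
      1 + z * ((1 + w) ^ b - 1) := by
    have h1 : ∀ F : Finset (Fin b), w ^ F.card * z ^ (if F.Nonempty then 1 else 0) =
        z * (w ^ F.card * 1 ^ (Fintype.card (Fin b) - F.card)) +
          (if F = ∅ then 1 - z else 0) := by
      intro F
      rcases F.eq_empty_or_nonempty with rfl | h
      · simp
      · simp [h, h.ne_empty]; ring
    rw [Finset.sum_congr rfl fun F _ => h1 F, Finset.sum_add_distrib, ← Finset.mul_sum,
      Fintype.sum_pow_mul_eq_add_pow]
    simp
    ring
  -- A subset is the family of its traces on the blocks, and both weights are multiplicative over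
  -- blocks.
  let e : Finset (P × Fin b) ≃ (P → Finset (Fin b)) :=
    { toFun := fun T p => univ.filter fun i => (p, i) ∈ T
      invFun := fun f => univ.filter fun x => x.2 ∈ f x.1
      left_inv := fun T => by ext x; simp
      right_inv := fun f => by ext p i; simp }
  have key : ∀ T : Finset (P × Fin b), w ^ T.card * z ^ (T.image Prod.fst).card =
      ∏ p, (w ^ (e T p).card * z ^ (if (e T p).Nonempty then 1 else 0)) := by
    intro T
    rw [Finset.prod_mul_distrib, Finset.prod_pow_eq_pow_sum, Finset.prod_pow_eq_pow_sum]
    congr 2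
    · rw [Finset.card_eq_sum_card_fiberwise (f := Prod.fst) (t := univ) (by simp)]
      refine Finset.sum_congr rfl fun p _ => ?_
      refine Finset.card_bij' (fun x _ => x.2) (fun i _ => (p, i)) ?_ ?_ ?_ ?_
      · rintro ⟨x, i⟩ h
        simp only [mem_filter] at h
        obtain ⟨h, rfl⟩ := h
        simpa [e] using h
      · intro i h
        simpa [e] using h
      · rintro ⟨x, i⟩ h
        simp only [mem_filter] at h
        obtain ⟨h, rfl⟩ := h
        rfl
      · intro i h
        rfl
    · rw [Finset.sum_boole]
      simp only [Nat.cast_id]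
      congr 1
      ext p
      simp [e, Finset.Nonempty]
  rw [Finset.sum_congr rfl fun T _ => key T,
    Equiv.sum_comp e (fun f => ∏ p, (w ^ (f p).card * z ^ (if (f p).Nonempty then 1 else 0)))]
  have := Finset.prod_univ_sum (fun _ : P => (univ : Finset (Finset (Fin b))))
    (fun _ F => w ^ F.card * z ^ (if F.Nonempty then 1 else 0))
  rw [Fintype.piFinset_univ] at this
  rw [← this, Finset.prod_congr rfl fun _ _ => hin]
  simp

/-- All terms of the generating function are nonnegative, so each `w ≥ 0` bounds the coefficient of
`w ^ t`; `w` stays free for optimization. -/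
theorem mul_sum_powersetCard_le {P : Type*} [Fintype P] [DecidableEq P] (b t : ℕ)
    {w z : ℝ} (hw : 0 ≤ w) (hz : 0 ≤ z) :
    w ^ t * ∑ T ∈ powersetCard t (univ : Finset (P × Fin b)), z ^ (T.image Prod.fst).card ≤
      (1 + z * ((1 + w) ^ b - 1)) ^ Fintype.card P := by
  rw [← sum_pow_card_mul_pow_card_image_fst, Finset.mul_sum]
  calc _ = ∑ T ∈ powersetCard t (univ : Finset (P × Fin b)),
        w ^ T.card * z ^ (T.image Prod.fst).card :=
        Finset.sum_congr rfl fun T hT => by rw [(mem_powersetCard.1 hT).2]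
    _ ≤ _ := Finset.sum_le_sum_of_subset_of_nonneg (Finset.subset_univ _)
        fun _ _ _ => by positivity

variable {X : Type*} [Fintype X] [DecidableEq X]

theorem exists_perm_image_eq {T T' : Finset X} (h : T.card = T'.card) :
    ∃ π : Equiv.Perm X, T.image π = T' := by
  have e : {x // x ∈ T} ≃ {x // x ∈ T'} := Fintype.equivOfCardEq (by simpa using h)
  refine ⟨e.extendSubtype, Finset.eq_of_subset_of_card_le ?_ ?_⟩
  · intro y hy
    obtain ⟨x, hx, rfl⟩ := mem_image.1 hy
    exact e.extendSubtype_mem x hx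
  · rw [Finset.card_image_of_injective _ (Equiv.injective _), h]

/-- Averaging over the images of a set under all permutations. -/
theorem choose_mul_sum_perm (F : Finset X → ℝ) (T : Finset X) :
    ((Fintype.card X).choose T.card : ℝ) * ∑ π : Equiv.Perm X, F (T.image π) =
      ((Fintype.card X).factorial : ℝ) * ∑ T' ∈ powersetCard T.card univ, F T' := by
  have h1 : ∀ T' ∈ powersetCard T.card (univ : Finset X),
      ∑ π : Equiv.Perm X, F (T'.image π) = ∑ π : Equiv.Perm X, F (T.image π) := by
    intro T' hT'
    obtain ⟨ρ, rfl⟩ := exists_perm_image_eq (mem_powersetCard.1 hT').2.symm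
    rw [← Equiv.sum_comp (Equiv.mulRight ρ) (fun π : Equiv.Perm X => F (T.image π))]
    refine Finset.sum_congr rfl fun π _ => ?_
    rw [Finset.image_image]
    rfl
  have h2 : ∀ π : Equiv.Perm X, ∑ T' ∈ powersetCard T.card univ, F (T'.image π) =
      ∑ T' ∈ powersetCard T.card univ, F T' := by
    intro π
    refine Finset.sum_bij' (fun T' _ => T'.image π) (fun T' _ => T'.image π.symm) ?_ ?_ ?_ ?_ ?_
    · intro T' h
      simpa [mem_powersetCard, Finset.card_image_of_injective _ π.injective] using h
    · intro T' h
      simpa [mem_powersetCard, Finset.card_image_of_injective _ π.symm.injective] using h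
    · intro T' _
      simp [Finset.image_image]
    · intro T' _
      simp [Finset.image_image]
    · intro T' _
      rfl
  calc _ = ∑ T' ∈ powersetCard T.card (univ : Finset X),
        ∑ π : Equiv.Perm X, F (T'.image π) := by
        rw [Finset.sum_congr rfl h1]; simp
    _ = ∑ π : Equiv.Perm X, ∑ T' ∈ powersetCard T.card (univ : Finset X), F (T'.image π) :=
        Finset.sum_comm
    _ = _ := by
        rw [Finset.sum_congr rfl fun π _ => h2 π]; simp [Fintype.card_perm]

theorem sum_range_quarter_pow_lt_one (M n : ℕ) :
    ∑ t ∈ range (n + 1), (if 1 ≤ t ∧ t ≤ M then (1 / 4 : ℝ) ^ t else 0) < 1 := by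
  have h : ∀ n : ℕ, ∑ t ∈ range (n + 1), (if 1 ≤ t ∧ t ≤ M then (1 / 4 : ℝ) ^ t else 0) ≤
      1 / 3 - (1 / 4 : ℝ) ^ n / 3 := by
    intro n
    induction n with
    | zero => norm_num
    | succ n ih =>
      rw [Finset.sum_range_succ]
      have hp : (0 : ℝ) < (1 / 4) ^ n := by positivity
      rw [pow_succ]
      split_ifs <;> linarith
  have := h n
  have hp : (0 : ℝ) < (1 / 4) ^ n := by positivity
  linarith

/-- First-moment method for tuples of permutations: if, for every size `t ≤ M`, an exponential
moment of `N` over the sets of size `t` is small enough, some tuple satisfies the lower bound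
`∑ j, N (π j T) ≥ η c |T|` for all sets `T` of size at most `M`. -/
theorem exists_perms_of_moment_le (N : Finset X → ℕ) (c M : ℕ) {η : ℝ}
    (H : ∀ t : ℕ, 1 ≤ t → t ≤ M → t ≤ Fintype.card X → ∃ z : ℝ, 0 < z ∧ z ≤ 1 ∧
      ((Fintype.card X).choose t : ℝ) * (z ^ (-(η * t)) *
        (∑ T ∈ powersetCard t (univ : Finset X), z ^ N T) / (Fintype.card X).choose t) ^ c ≤
        (1 / 4) ^ t) :
    ∃ π : Fin c → Equiv.Perm X, ∀ T : Finset X, T.card ≤ M →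
      η * c * T.card ≤ ∑ j, (N (T.image (π j)) : ℝ) := by
  classical
  by_contra! hcon
  choose! z hz0 hz1 hz using H
  set s := Fintype.card X with hs
  -- The Chernoff weight: since `z ≤ 1`, it is at least `1` at every `T` that violates the bound for
  -- `π`.
  let W : (Fin c → Equiv.Perm X) → Finset X → ℝ := fun π T =>
    if 1 ≤ T.card ∧ T.card ≤ M then
      ∏ j, (z T.card ^ (-(η * T.card)) * z T.card ^ N (T.image (π j))) else 0
  have hWnn : ∀ π T, 0 ≤ W π T := by
    intro π T
    simp only [W]
    split_ifs with h
    · have := hz0 T.card h.1 h.2 (Finset.card_le_univ T)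
      positivity
    · exact le_rfl
  have h1 : ∀ π : Fin c → Equiv.Perm X, 1 ≤ ∑ T : Finset X, W π T := by
    intro π
    obtain ⟨T, hTM, hT⟩ := hcon π
    have hT1 : 1 ≤ T.card := by
      rw [Nat.one_le_iff_ne_zero]
      intro h0
      rw [Finset.card_eq_zero] at h0
      subst h0
      rw [Finset.card_empty, Nat.cast_zero, mul_zero] at hT
      exact absurd hT (not_lt.2 (Finset.sum_nonneg fun _ _ => Nat.cast_nonneg _))
    refine le_trans ?_ (Finset.single_le_sum (fun T _ => hWnn π T) (mem_univ T))
    have hzp := hz0 T.card hT1 hTM (Finset.card_le_univ T)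
    have hzl := hz1 T.card hT1 hTM (Finset.card_le_univ T)
    simp only [W, if_pos (And.intro hT1 hTM)]
    have : ∀ j, z T.card ^ (-(η * T.card)) * z T.card ^ N (T.image (π j)) =
        z T.card ^ (-(η * T.card) + (N (T.image (π j)) : ℝ)) := by
      intro j
      rw [Real.rpow_add hzp, Real.rpow_natCast]
    rw [Finset.prod_congr rfl fun j _ => this j, ← Real.rpow_sum_of_pos hzp]
    refine Real.one_le_rpow_of_pos_of_le_one_of_nonpos hzp hzl ?_
    rw [Finset.sum_add_distrib]
    simp
    linarith
  -- The `c` permutations vary independently, and each carries `T` to a uniform set of its size.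
  have h2 : ∀ T : Finset X, ∑ π : Fin c → Equiv.Perm X, W π T =
      (s.factorial : ℝ) ^ c * (if 1 ≤ T.card ∧ T.card ≤ M then
        (z T.card ^ (-(η * T.card)) *
        (∑ T' ∈ powersetCard T.card (univ : Finset X), z T.card ^ N T') / s.choose T.card) ^ c
        else 0) := by
    intro T
    simp only [W]
    split_ifs with h
    · rw [← Fintype.sum_pow (fun π : Equiv.Perm X =>
        z T.card ^ (-(η * T.card)) * z T.card ^ N (T.image π)), ← mul_pow, ← Finset.mul_sum]
      congr 1
      have := choose_mul_sum_perm (fun T' => z T.card ^ N T') T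
      have hc : (0 : ℝ) < s.choose T.card := by
        exact_mod_cast Nat.choose_pos (Finset.card_le_univ T)
      rw [mul_div_assoc', eq_div_iff hc.ne']
      linear_combination (z T.card ^ (-(η * T.card))) * this
    · simp
  have h3 : ∑ π : Fin c → Equiv.Perm X, (1 : ℝ) ≤
      ∑ π : Fin c → Equiv.Perm X, ∑ T : Finset X, W π T :=
    Finset.sum_le_sum fun π _ => h1 π
  rw [Finset.sum_comm, Finset.sum_congr rfl fun T _ => h2 T, ← Finset.mul_sum] at h3
  have h4 := Finset.sum_powerset_apply_card (x := (univ : Finset X)) (fun t => if 1 ≤ t ∧ t ≤ M then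
        (z t ^ (-(η * t)) *
        (∑ T' ∈ powersetCard t (univ : Finset X), z t ^ N T') / s.choose t) ^ c
        else 0)
  rw [Finset.powerset_univ] at h4
  rw [h4] at h3
  have h5 : ∑ π : Fin c → Equiv.Perm X, (1 : ℝ) = (s.factorial : ℝ) ^ c := by
    simp [Fintype.card_perm, hs]
  rw [h5] at h3
  have hpos : (0 : ℝ) < (s.factorial : ℝ) ^ c := by positivity
  have h6 := sum_range_quarter_pow_lt_one M s
  have h7 : ∑ t ∈ range ((univ : Finset X).card + 1), (univ : Finset X).card.choose t •
      (if 1 ≤ t ∧ t ≤ M then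
        (z t ^ (-(η * t)) *
        (∑ T' ∈ powersetCard t (univ : Finset X), z t ^ N T') / s.choose t) ^ c
        else 0) ≤ ∑ t ∈ range (s + 1), (if 1 ≤ t ∧ t ≤ M then (1 / 4 : ℝ) ^ t else 0) := by
    rw [Finset.card_univ, ← hs]
    refine Finset.sum_le_sum fun t ht => ?_
    split_ifs with h
    · rw [nsmul_eq_mul]
      exact hz t h.1 h.2 (Nat.lt_succ_iff.1 (mem_range.1 ht))
    · simp
  nlinarith

end Counting

/-! ### Moment estimates for small and large sets, and the random layers. -/

section Moments

theorem choose_le_exp_div_pow {s t : ℕ} (ht : 1 ≤ t) :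
    (s.choose t : ℝ) ≤ (Real.exp 1 * (s / t)) ^ t := by
  have ht0 : (0 : ℝ) < t := by exact_mod_cast ht
  have h1 := Nat.choose_le_pow_div (α := ℝ) t s
  have h2 := Real.pow_div_factorial_le_exp (x := t) ht0.le t
  have h3 : (0 : ℝ) < (t.factorial : ℝ) := by positivity
  rw [mul_pow, div_pow, ← Real.exp_nat_mul, mul_one]
  calc (s.choose t : ℝ) ≤ s ^ t / t.factorial := h1
    _ = ((t : ℝ) ^ t / t.factorial) * (s ^ t / t ^ t) := by field_simp
    _ ≤ _ := by gcongr

theorem div_two_mul_pow_le_choose {s t : ℕ} (ht : 1 ≤ t) (hts : 2 * t ≤ s) :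
    ((s : ℝ) / (2 * t)) ^ t ≤ s.choose t := by
  have ht0 : (0 : ℝ) < t := by exact_mod_cast ht
  refine le_trans ?_ (Nat.pow_le_choose (α := ℝ) t s)
  have h1 : (s : ℝ) / 2 ≤ ((s + 1 - t : ℕ) : ℝ) := by
    rw [Nat.cast_sub (by omega)]
    have : (2 : ℝ) * t ≤ s := by exact_mod_cast hts
    push_cast
    linarith
  have h2 : (t.factorial : ℝ) ≤ (t : ℝ) ^ t := by exact_mod_cast Nat.factorial_le_pow t
  calc ((s : ℝ) / (2 * t)) ^ t = ((s : ℝ) / 2) ^ t / t ^ t := by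
        rw [← div_pow]; congr 1; field_simp
    _ ≤ _ := by gcongr

/-- The value of the binomial distribution at its mean is at least `1 / (s + 1)`. -/
theorem pow_le_succ_mul_choose_mul_pow {s t : ℕ} (hts : t ≤ s) :
    (s : ℝ) ^ s ≤ (s + 1) * (s.choose t * ((t : ℝ) ^ t * ((s - t : ℕ) : ℝ) ^ (s - t))) := by
  obtain ⟨r, rfl⟩ := Nat.exists_eq_add_of_le hts
  -- The `s + 1` terms of the binomial expansion of `(t + r) ^ (t + r)`; the ratio of consecutive
  -- terms shows that they peak at `j = t`.
  let g : ℕ → ℕ := fun j => t ^ j * r ^ (t + r - j) * (t + r).choose j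
  have hstep : ∀ j, j < t + r → (j + 1) * g (j + 1) * r = (t + r - j) * g j * t := by
    intro j hj
    have h1 := Nat.choose_succ_right_eq (t + r) j
    have h2 : r ^ (t + r - j) = r ^ (t + r - (j + 1)) * r := by
      rw [← pow_succ]; congr 1; omega
    simp only [g]
    rw [h2, pow_succ]
    calc _ = t ^ j * t * r ^ (t + r - (j + 1)) * r * ((t + r).choose (j + 1) * (j + 1)) := by ring
      _ = _ := by rw [h1]; ring
  have hup : ∀ i, i ≤ t → g (t - i) ≤ g t := by
    intro i
    induction i with
    | zero => intro _; exact le_rfl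
    | succ i ih =>
      intro hi
      refine le_trans ?_ (ih (by omega))
      obtain ⟨j, hj⟩ : ∃ j, j = t - (i + 1) := ⟨_, rfl⟩
      have hj' : t - i = j + 1 := by omega
      rw [← hj, hj']
      have h := hstep j (by omega)
      rcases Nat.eq_zero_or_pos r with hr | hr
      · have : g j = 0 := by
          simp only [g]; rw [hr, zero_pow (by omega)]; simp
        omega
      · have h1 : (j + 1) * r ≤ (t + r - j) * t := by
          have : (j + 1) ≤ t := by omega
          have : r ≤ t + r - j := by omega
          calc (j + 1) * r ≤ t * (t + r - j) := Nat.mul_le_mul ‹_› ‹_›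
            _ = _ := by ring
        have h2 : 0 < (j + 1) * r := by positivity
        refine Nat.le_of_mul_le_mul_left ?_ h2
        calc (j + 1) * r * g j ≤ (t + r - j) * t * g j := Nat.mul_le_mul_right _ h1
          _ = (t + r - j) * g j * t := by ring
          _ = (j + 1) * r * g (j + 1) := by rw [← h]; ring
  have hdown : ∀ i, i ≤ r → g (t + i) ≤ g t := by
    intro i
    induction i with
    | zero => intro _; exact le_rfl
    | succ i ih =>
      intro hi
      refine le_trans ?_ (ih (by omega))
      have h := hstep (t + i) (by omega)
      have h1 : (t + r - (t + i)) * t ≤ (t + i + 1) * r := by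
        calc _ ≤ r * (t + i + 1) := Nat.mul_le_mul (by omega) (by omega)
          _ = _ := by ring
      have h2 : 0 < (t + i + 1) * r := by
        have : 0 < r := by omega
        positivity
      refine Nat.le_of_mul_le_mul_left ?_ h2
      calc (t + i + 1) * r * g (t + i + 1) = (t + i + 1) * g (t + i + 1) * r := by ring
        _ = (t + r - (t + i)) * t * g (t + i) := by rw [h]; ring
        _ ≤ _ := Nat.mul_le_mul_right _ h1
  have hall : ∀ j ∈ range (t + r + 1), g j ≤ g t := by
    intro j hj
    have hj := mem_range.1 hj
    rcases le_total j t with h | h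
    · have := hup (t - j) (by omega)
      rwa [Nat.sub_sub_self h] at this
    · have := hdown (j - t) (by omega)
      rwa [Nat.add_sub_cancel' h] at this
  have h := Finset.sum_le_sum hall
  have hb := add_pow t r (t + r)
  have hb' : ∑ i ∈ range (t + r + 1), g i = (t + r) ^ (t + r) := by rw [hb]; rfl
  rw [hb'] at h
  simp only [Finset.sum_const, Finset.card_range, smul_eq_mul, g] at h
  have h' : ((t + r : ℕ) : ℝ) ^ (t + r) ≤
      (t + r + 1) * (t ^ t * r ^ (t + r - t) * (t + r).choose t) := by exact_mod_cast h
  simp only [Nat.add_sub_cancel_left] at h' ⊢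
  refine h'.trans (le_of_eq ?_)
  push_cast
  ring

/-- The union bound for small sets. -/
theorem choose_mul_moment_pow_le_of_small {b : ℕ} {η τ₀ : ℝ} (hη : η < 1)
    (hτ₀ : τ₀ ≤ 1 / 12) (hK : 2 * Real.exp (2 ^ b) * τ₀ ^ ((1 - η) / 2) ≤ 1)
    {c : ℕ} (hc : 4 ≤ c * (1 - η)) {s t : ℕ} (ht : 1 ≤ t) {A : ℝ} (hA0 : 0 ≤ A)
    (hts : (t : ℝ) ≤ τ₀ * s) (hA : A ≤ Real.exp (2 ^ b) ^ t) :
    (s.choose t : ℝ) * (((t : ℝ) / s) ^ (-(η * t)) * A / s.choose t) ^ c ≤ (1 / 4) ^ t := by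
  have ht0 : (0 : ℝ) < t := by exact_mod_cast ht
  have hs0 : (0 : ℝ) < s := by
    rcases (Nat.cast_nonneg (α := ℝ) s).eq_or_lt with h | h
    · rw [← h] at hts; linarith
    · exact h
  have hts2 : 2 * t ≤ s := by
    have : (2 : ℝ) * t ≤ s := by nlinarith
    exact_mod_cast this
  set τ : ℝ := t / s with hτ
  have hτ0 : 0 < τ := by positivity
  have hττ₀ : τ ≤ τ₀ := by rw [hτ, div_le_iff₀ hs0]; exact hts
  set C : ℝ := (s.choose t : ℝ) with hC
  have hC1 : C ≤ (Real.exp 1 * τ⁻¹) ^ t := by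
    rw [hτ, inv_div]; exact choose_le_exp_div_pow ht
  have hC2 : (1 / (2 * τ)) ^ t ≤ C := by
    have := div_two_mul_pow_le_choose ht hts2
    rw [hτ]
    convert this using 2
    field_simp
  have hC0 : 0 < C := lt_of_lt_of_le (by positivity) hC2
  set E := Real.exp (2 ^ b) with hE
  have hE0 : 0 < E := Real.exp_pos _
  -- The base is `2 E τ ^ (1 - η)`; half of the exponent absorbs `2 E` by `hK`, and the other half
  -- remains.
  have hu : τ ^ (-(η * t)) * A / C ≤ (τ ^ ((1 - η) / 2)) ^ t := by
    have h1 : τ ^ (-(η * t)) = (τ ^ (-η)) ^ t := by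
      rw [← Real.rpow_natCast, ← Real.rpow_mul hτ0.le]; ring_nf
    have h2 : A / C ≤ (2 * E * τ) ^ t := by
      rw [div_le_iff₀ hC0]
      calc A ≤ E ^ t := hA
        _ = (2 * E * τ) ^ t * (1 / (2 * τ)) ^ t := by
            rw [← mul_pow]; congr 1; field_simp
        _ ≤ _ := by gcongr
    rw [h1, mul_div_assoc]
    calc (τ ^ (-η)) ^ t * (A / C) ≤ (τ ^ (-η)) ^ t * (2 * E * τ) ^ t := by gcongr
      _ = (τ ^ (-η) * (2 * E * τ)) ^ t := (mul_pow _ _ _).symm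
      _ ≤ _ := by
        refine pow_le_pow_left₀ (by positivity) ?_ t
        have h3 : τ ^ (-η) * τ = τ ^ ((1 - η) / 2) * τ ^ ((1 - η) / 2) := by
          rw [← Real.rpow_add hτ0]
          nth_rewrite 2 [← Real.rpow_one τ]
          rw [← Real.rpow_add hτ0]
          ring_nf
        have h4 : τ ^ ((1 - η) / 2) ≤ τ₀ ^ ((1 - η) / 2) :=
          Real.rpow_le_rpow hτ0.le hττ₀ (by linarith)
        have h5 : 0 < τ ^ ((1 - η) / 2) := by positivity
        calc τ ^ (-η) * (2 * E * τ) = (2 * E) * (τ ^ (-η) * τ) := by ring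
          _ = (2 * E * τ ^ ((1 - η) / 2)) * τ ^ ((1 - η) / 2) := by rw [h3]; ring
          _ ≤ (2 * E * τ₀ ^ ((1 - η) / 2)) * τ ^ ((1 - η) / 2) := by gcongr
          _ ≤ 1 * τ ^ ((1 - η) / 2) := by gcongr
          _ = _ := one_mul _
  -- Since `c (1 - η) / 2 ≥ 2`, this gains `τ ^ 2` per element, against at most `(e / τ) ^ t` sets
  -- of size `t`.
  have huc : (τ ^ (-(η * t)) * A / C) ^ c ≤ (τ ^ 2) ^ t := by
    calc (τ ^ (-(η * t)) * A / C) ^ c ≤ ((τ ^ ((1 - η) / 2)) ^ t) ^ c := by gcongr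
      _ = ((τ ^ ((1 - η) / 2)) ^ c) ^ t := by rw [← pow_mul, ← pow_mul, mul_comm]
      _ ≤ (τ ^ 2) ^ t := by
        refine pow_le_pow_left₀ (by positivity) ?_ t
        rw [← Real.rpow_natCast, ← Real.rpow_natCast, ← Real.rpow_mul hτ0.le]
        refine Real.rpow_le_rpow_of_exponent_ge hτ0 (by linarith) ?_
        push_cast
        linarith
  calc C * (τ ^ (-(η * t)) * A / C) ^ c ≤ (Real.exp 1 * τ⁻¹) ^ t * (τ ^ 2) ^ t := by gcongr
    _ = (Real.exp 1 * τ) ^ t := by rw [← mul_pow]; congr 1; field_simp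
    _ ≤ (1 / 4) ^ t := by
      refine pow_le_pow_left₀ (by positivity) ?_ t
      have := Real.exp_one_lt_three
      nlinarith [Real.exp_pos 1]

/-- The exponential moment of the number of blocks met, for sets of density at most `1 / k`. -/
theorem moment_le_of_large {a b : ℕ} {k δ η z : ℝ} (hk : 1 < k)
    (h : δ * b ≤ ∑ j ∈ range b, (1 - 1 / k) ^ j) (hη : 0 ≤ η) (hz0 : 0 < z) (hz1 : z ≤ 1)
    {t : ℕ} (ht : 1 ≤ t) (htk : (t : ℝ) * k ≤ ((a * b : ℕ) : ℝ)) {A : ℝ}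
    (hA : ∀ w : ℝ, 0 ≤ w → w ^ t * A ≤ (1 + z * ((1 + w) ^ b - 1)) ^ a) :
    z ^ (-(η * t)) * A / ((a * b).choose t : ℝ) ≤
      (((a * b : ℕ) : ℝ) + 1) * Real.exp (-((δ - η / z) * (1 - z) * t)) := by
  set s := a * b with hs
  have ht0 : (0 : ℝ) < t := by exact_mod_cast ht
  have hts' : (t : ℝ) < s := by nlinarith
  have hts : t < s := by exact_mod_cast hts'
  have hs0 : (0 : ℝ) < s := by linarith
  set τ : ℝ := t / s with hτ
  have hτ0 : 0 < τ := by positivity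
  have hτ1 : τ < 1 := by rw [hτ, div_lt_one hs0]; exact hts'
  have hτk : τ ≤ 1 / k := by
    rw [hτ, div_le_div_iff₀ hs0 (by linarith)]; linarith
  have hq : 0 < 1 - τ := by linarith
  set B : ℝ := τ ^ t * (1 - τ) ^ (s - t) with hB
  have hB0 : 0 < B := by positivity
  -- Replacing a uniform `t`-set by independent sampling with density `τ` costs only a factor `s +
  -- 1`.
  have hC : 1 ≤ ((s : ℝ) + 1) * (s.choose t * B) := by
    have h1 := pow_le_succ_mul_choose_mul_pow hts.le
    have h2 : (t : ℝ) ^ t * ((s - t : ℕ) : ℝ) ^ (s - t) = (s : ℝ) ^ s * B := by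
      have h3 : ((s - t : ℕ) : ℝ) = s * (1 - τ) := by
        rw [Nat.cast_sub hts.le, hτ]; field_simp
      have h4 : (t : ℝ) = s * τ := by rw [hτ]; field_simp
      have h5 : (s : ℝ) ^ s = s ^ t * s ^ (s - t) := by
        rw [← pow_add]; congr 1; omega
      rw [h3, h5, hB]
      nth_rewrite 1 [h4]
      rw [mul_pow, mul_pow]
      ring
    rw [h2] at h1
    have h6 : (0 : ℝ) < (s : ℝ) ^ s := by positivity
    refine le_of_mul_le_mul_left ?_ h6
    calc (s : ℝ) ^ s * 1 ≤ (s + 1) * (s.choose t * ((s : ℝ) ^ s * B)) := by rw [mul_one]; exact h1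
      _ = _ := by ring
  -- The probability that independent sampling with density `τ` meets a given block.
  set p : ℝ := 1 - (1 - τ) ^ b with hp
  have hap : δ * t ≤ a * p := by
    have h1 : p = τ * ∑ j ∈ range b, (1 - τ) ^ j := by
      rw [hp, ← mul_neg_geom_sum]; ring
    have h2 : ∑ j ∈ range b, (1 - 1 / k) ^ j ≤ ∑ j ∈ range b, (1 - τ) ^ j := by
      have hk1 : 0 ≤ 1 - 1 / k := by
        rw [sub_nonneg, div_le_one (by linarith)]; linarith
      refine Finset.sum_le_sum fun j _ => pow_le_pow_left₀ hk1 (by linarith) j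
    have h3 : (t : ℝ) = a * b * τ := by
      have : (s : ℝ) = a * b := by rw [hs]; push_cast; ring
      rw [hτ, ← this]; field_simp
    rw [h1]
    calc δ * t = a * τ * (δ * b) := by rw [h3]; ring
      _ ≤ a * τ * ∑ j ∈ range b, (1 - τ) ^ j := by
        refine mul_le_mul_of_nonneg_left (h.trans h2) (by positivity)
      _ = _ := by ring
  have hAB : A * B ≤ Real.exp (-(δ * t * (1 - z))) := by
    -- With `w` the odds of `τ`, the generating function becomes the moment for independent
    -- sampling.
    have h1 := hA (τ / (1 - τ)) (by positivity)
    have h2 : 1 + z * ((1 + τ / (1 - τ)) ^ b - 1) = (1 - p * (1 - z)) / (1 - τ) ^ b := by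
      have : 1 + τ / (1 - τ) = 1 / (1 - τ) := by field_simp; ring
      rw [this, hp, div_pow, one_pow]
      field_simp
      ring
    rw [h2, div_pow, div_pow (1 - p * (1 - z)), ← pow_mul, mul_comm b a, ← hs, le_div_iff₀ (by positivity)] at h1
    have h3 : τ ^ t / (1 - τ) ^ t * A * (1 - τ) ^ s = A * B := by
      have : (1 - τ) ^ s = (1 - τ) ^ t * (1 - τ) ^ (s - t) := by
        rw [← pow_add]; congr 1; omega
      rw [this, hB]
      field_simp
    rw [h3] at h1
    have hp0 : 0 ≤ p := by
      rw [hp, sub_nonneg]; exact pow_le_one₀ hq.le (by linarith)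
    have hp1 : p ≤ 1 := by
      rw [hp]; have : 0 < (1 - τ) ^ b := by positivity
      linarith
    calc A * B ≤ (1 - p * (1 - z)) ^ a := h1
      _ ≤ (Real.exp (-(p * (1 - z)))) ^ a := by
        refine pow_le_pow_left₀ (by nlinarith) ?_ a
        have := Real.add_one_le_exp (-(p * (1 - z)))
        linarith
      _ = Real.exp (-(a * p * (1 - z))) := by rw [← Real.exp_nat_mul]; ring_nf
      _ ≤ _ := by
        refine Real.exp_le_exp.2 (neg_le_neg ?_)
        exact mul_le_mul_of_nonneg_right hap (by linarith)
  have hzη : z ^ (-(η * t)) ≤ Real.exp (η / z * (1 - z) * t) := by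
    rw [Real.rpow_def_of_pos hz0]
    refine Real.exp_le_exp.2 ?_
    have h1 := Real.one_sub_inv_le_log_of_pos hz0
    have h2 : 0 ≤ η * t := by positivity
    calc Real.log z * -(η * t) = (η * t) * (-Real.log z) := by ring
      _ ≤ (η * t) * (z⁻¹ - 1) := mul_le_mul_of_nonneg_left (by linarith) h2
      _ = _ := by field_simp
  have hC0 : (0 : ℝ) < s.choose t := by exact_mod_cast Nat.choose_pos hts.le
  rw [div_le_iff₀ hC0]
  have hA1 : A ≤ Real.exp (-(δ * t * (1 - z))) / B := by rwa [le_div_iff₀ hB0]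
  have hA2 : A ≤ Real.exp (-(δ * t * (1 - z))) * ((s + 1) * s.choose t) := by
    refine hA1.trans ?_
    rw [div_le_iff₀ hB0]
    calc _ = Real.exp (-(δ * t * (1 - z))) * 1 := (mul_one _).symm
      _ ≤ Real.exp (-(δ * t * (1 - z))) * ((s + 1) * (s.choose t * B)) := by gcongr
      _ = _ := by ring
  have hzpos : 0 < z ^ (-(η * t)) := Real.rpow_pos_of_pos hz0 _
  calc z ^ (-(η * t)) * A
      ≤ z ^ (-(η * t)) * (Real.exp (-(δ * t * (1 - z))) * ((s + 1) * s.choose t)) := by gcongr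
    _ ≤ Real.exp (η / z * (1 - z) * t) *
        (Real.exp (-(δ * t * (1 - z))) * ((s + 1) * s.choose t)) := by gcongr
    _ = (s + 1) * (Real.exp (η / z * (1 - z) * t) * Real.exp (-(δ * t * (1 - z)))) *
        s.choose t := by ring
    _ = _ := by rw [← Real.exp_add]; ring_nf

theorem exp_neg_two_le : Real.exp (-2) ≤ 1 / 4 := by
  have h6 : Real.exp 2 = Real.exp 1 * Real.exp 1 := by rw [← Real.exp_add]; norm_num
  have h7 := Real.add_one_le_exp (1 : ℝ)
  rw [Real.exp_neg, one_div, h6]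
  exact inv_anti₀ (by norm_num) (by nlinarith)

/-- The union bound for large sets. -/
theorem choose_mul_moment_pow_le_of_large {s t c : ℕ} {κ τ₀ ρ G : ℝ} (hκ : 0 ≤ κ)
    (hρ : ρ = κ * τ₀ / 2) (hs : (s : ℝ) + 1 ≤ Real.exp (ρ * s)) (hc : 3 ≤ c * ρ)
    (ht : τ₀ * s ≤ t) (hts : (t : ℝ) ≤ s) (hG0 : 0 ≤ G)
    (hG : G ≤ ((s : ℝ) + 1) * Real.exp (-(κ * t))) :
    (s.choose t : ℝ) * G ^ c ≤ (1 / 4) ^ t := by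
  have h2 : G ≤ Real.exp (-(ρ * s)) := by
    calc G ≤ ((s : ℝ) + 1) * Real.exp (-(κ * t)) := hG
      _ ≤ Real.exp (ρ * s) * Real.exp (-(κ * (τ₀ * s))) := by gcongr
      _ = _ := by rw [← Real.exp_add, hρ]; ring_nf
  have h3 : (s.choose t : ℝ) ≤ Real.exp s := by
    calc (s.choose t : ℝ) ≤ 2 ^ s := by exact_mod_cast Nat.choose_le_two_pow s t
      _ ≤ (Real.exp 1) ^ s := by
        gcongr
        linarith [Real.add_one_le_exp (1 : ℝ)]
      _ = _ := by rw [← Real.exp_nat_mul, mul_one]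
  have h4 : 3 * (s : ℝ) ≤ c * ρ * s := by gcongr
  calc _ ≤ Real.exp s * (Real.exp (-(ρ * s))) ^ c := by gcongr
    _ = Real.exp (s - c * ρ * s) := by
        rw [← Real.exp_nat_mul, ← Real.exp_add]; ring_nf
    _ ≤ Real.exp (-(2 * t)) := by
        refine Real.exp_le_exp.2 ?_
        linarith
    _ = (Real.exp (-2)) ^ t := by rw [← Real.exp_nat_mul]; ring_nf
    _ ≤ (1 / 4) ^ t := pow_le_pow_left₀ (Real.exp_pos _).le exp_neg_two_le t

theorem exists_pos_le_mul_rpow_le_one {K x : ℝ} (hK : 0 < K) (hx : 0 < x) :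
    ∃ τ : ℝ, 0 < τ ∧ τ ≤ 1 / 12 ∧ K * τ ^ x ≤ 1 := by
  refine ⟨min (1 / 12) ((1 / K) ^ (1 / x)), by positivity, min_le_left _ _, ?_⟩
  have h1 : (min (1 / 12) ((1 / K) ^ (1 / x))) ^ x ≤ ((1 / K) ^ (1 / x)) ^ x :=
    Real.rpow_le_rpow (by positivity) (min_le_right _ _) hx.le
  rw [← Real.rpow_mul (by positivity), one_div_mul_cancel hx.ne', Real.rpow_one] at h1
  calc _ ≤ K * (1 / K) := by gcongr
    _ = 1 := by field_simp

/-- Random permutations of `P × Fin b` give `c` partitions into blocks of size `b` for which every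
set of density at most `1 / k` meets many blocks. -/
theorem exists_layers {b : ℕ} (hb : 1 ≤ b) {k δ η : ℝ} (hk : 1 < k) (hδ1 : δ ≤ 1) (hη : 0 < η)
    (hηδ : η < δ) (h : δ * b ≤ ∑ j ∈ range b, (1 - 1 / k) ^ j) :
    ∃ c₀ a₀ : ℕ, ∀ c : ℕ, c₀ ≤ c → ∀ (P : Type) [Fintype P] [DecidableEq P],
      a₀ ≤ Fintype.card P → ∃ π : Fin c → Equiv.Perm (P × Fin b), ∀ T : Finset (P × Fin b),
        (T.card : ℝ) * k ≤ (Fintype.card P * b : ℕ) →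
        η * c * T.card ≤ ∑ j, ((T.image fun x => (π j x).1).card : ℝ) := by
  have hη1 : η < 1 := by linarith
  obtain ⟨τ₀, hτ0, hτ12, hτK⟩ := exists_pos_le_mul_rpow_le_one
    (K := 2 * Real.exp (2 ^ b)) (x := (1 - η) / 2) (by positivity) (by linarith)
  -- Midway between `η / δ` and `1`, which makes both factors of `κ` positive.
  set z : ℝ := (1 + η / δ) / 2 with hz
  have hδ0 : 0 < δ := by linarith
  have hηδ1 : η / δ < 1 := by rw [div_lt_one hδ0]; exact hηδ
  have hηδ0 : 0 < η / δ := by positivity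
  have hz0 : 0 < z := by rw [hz]; positivity
  have hz1 : z < 1 := by rw [hz]; linarith
  have hzη : η / δ < z := by rw [hz]; linarith
  set κ : ℝ := (δ - η / z) * (1 - z) with hκ
  have hκ0 : 0 < κ := by
    refine mul_pos (sub_pos.2 ?_) (by linarith)
    rw [div_lt_iff₀ hz0]
    rw [div_lt_iff₀ hδ0] at hzη
    linarith
  set ρ : ℝ := κ * τ₀ / 2 with hρ
  have hρ0 : 0 < ρ := by positivity
  refine ⟨max ⌈4 / (1 - η)⌉₊ ⌈3 / ρ⌉₊, ⌈2 / ρ ^ 2⌉₊, ?_⟩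
  intro c hc P _ _ ha
  have hc1 : 4 ≤ c * (1 - η) := by
    have := (Nat.le_ceil (4 / (1 - η))).trans
      (Nat.cast_le.2 ((le_max_left _ _).trans hc) : ((⌈4 / (1 - η)⌉₊ : ℕ) : ℝ) ≤ c)
    rwa [div_le_iff₀ (by linarith)] at this
  have hc2 : 3 ≤ c * ρ := by
    have := (Nat.le_ceil (3 / ρ)).trans
      (Nat.cast_le.2 ((le_max_right _ _).trans hc) : ((⌈3 / ρ⌉₊ : ℕ) : ℝ) ≤ c)
    rwa [div_le_iff₀ hρ0] at this
  set a := Fintype.card P with ha'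
  set s := a * b with hs
  have hsa : a ≤ s := Nat.le_mul_of_pos_right a hb
  have hs1 : (s : ℝ) + 1 ≤ Real.exp (ρ * s) := by
    have h1 : 2 / ρ ^ 2 ≤ (s : ℝ) := (Nat.le_ceil _).trans (Nat.cast_le.2 (ha.trans hsa))
    have h2 := Real.quadratic_le_exp_of_nonneg (x := ρ * s) (by positivity)
    rw [div_le_iff₀ (by positivity)] at h1
    have h3 : (0 : ℝ) ≤ s := Nat.cast_nonneg s
    have h4 : (s : ℝ) * 2 ≤ s * (s * ρ ^ 2) := by gcongr
    nlinarith
  have hcard : Fintype.card (P × Fin b) = s := by simp [hs, ha']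
  obtain ⟨π, hπ⟩ := exists_perms_of_moment_le (X := P × Fin b)
    (fun T => (T.image Prod.fst).card) c ⌊(s : ℝ) / k⌋₊ (η := η) (by
      intro t ht htM _
      have htk : (t : ℝ) * k ≤ (s : ℝ) := by
        rw [← le_div_iff₀ (by linarith)]
        exact (Nat.cast_le.2 htM).trans (Nat.floor_le (by positivity))
      have ht0 : (0 : ℝ) < t := by exact_mod_cast ht
      have hts' : (t : ℝ) < s := by nlinarith
      have hs0 : (0 : ℝ) < s := by linarith
      rw [hcard]
      by_cases hsmall : (t : ℝ) ≤ τ₀ * s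
      -- For small sets `z` must shrink with the density; `w = 1` then already gives a moment of at
      -- most `exp (2 ^ b) ^ t`.
      · refine ⟨t / s, by positivity, by rw [div_le_one hs0]; exact hts'.le, ?_⟩
        refine choose_mul_moment_pow_le_of_small hη1 hτ12 hτK hc1 ht (by positivity) hsmall ?_
        have h1 := mul_sum_powersetCard_le (P := P) b t zero_le_one
          (z := (t : ℝ) / s) (by positivity)
        rw [one_pow, one_mul] at h1
        refine h1.trans ?_
        have h2 : (1 + (t : ℝ) / s * ((1 + 1) ^ b - 1)) ≤ Real.exp ((t : ℝ) / s * 2 ^ b) := by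
          have h3 := Real.add_one_le_exp ((t : ℝ) / s * 2 ^ b)
          have h4 : 0 < (t : ℝ) / s := by positivity
          norm_num at h3 ⊢
          linarith
        have h5 : (1 : ℝ) ≤ (1 + 1) ^ b := one_le_pow₀ (by norm_num)
        calc _ ≤ (Real.exp ((t : ℝ) / s * 2 ^ b)) ^ a := by
              refine pow_le_pow_left₀ ?_ h2 a
              have : 0 ≤ (t : ℝ) / s * ((1 + 1) ^ b - 1) :=
                mul_nonneg (by positivity) (by linarith)
              linarith
          _ = Real.exp (a / s * (t * 2 ^ b)) := by rw [← Real.exp_nat_mul]; ring_nf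
          _ ≤ Real.exp (1 * (t * 2 ^ b)) := by
              refine Real.exp_le_exp.2 (mul_le_mul_of_nonneg_right ?_ (by positivity))
              rw [div_le_one hs0]
              exact_mod_cast hsa
          _ = _ := by rw [← Real.exp_nat_mul]; ring_nf
      · push Not at hsmall
        refine ⟨z, hz0, hz1.le, ?_⟩
        have h1 := moment_le_of_large (a := a) (b := b) hk h hη.le hz0 hz1.le ht htk
          (A := ∑ T ∈ powersetCard t (univ : Finset (P × Fin b)), z ^ (T.image Prod.fst).card)
          (fun w hw => mul_sum_powersetCard_le b t hw hz0.le)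
        rw [← hs, ← hκ] at h1
        exact choose_mul_moment_pow_le_of_large hκ0.le hρ hs1 hc2 hsmall.le hts'.le
          (by positivity) h1)
  refine ⟨π, fun T hT => ?_⟩
  have h1 := hπ T (by
    refine Nat.le_floor ?_
    rw [le_div_iff₀ (by linarith)]
    exact hT)
  simpa only [Finset.image_image, Function.comp_def] using h1

end Moments

/-! ### The size-expansion function by linear programming duality. -/

section LinearProgram

theorem mul_one_sub_pow_eq_sum {k : ℝ} (hk : 1 < k) (n : ℕ) :
    k * (1 - (1 - 1 / k) ^ n) = ∑ j ∈ range n, (1 - 1 / k) ^ j := by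
  rw [← mul_neg_geom_sum]
  have : k ≠ 0 := by positivity
  field_simp
  ring

theorem one_sub_pow_le {q : ℝ} (hq0 : 0 ≤ q) (n : ℕ) : 1 - q ^ n ≤ n * (1 - q) := by
  have h := one_add_mul_le_pow (a := q - 1) (by linarith) n
  rw [add_sub_cancel] at h
  linarith

theorem le_one_sub_pow {q : ℝ} (hq0 : 0 ≤ q) (hq1 : q ≤ 1) (n : ℕ) :
    n * (1 - q) * q ^ n ≤ 1 - q ^ n := by
  rw [← mul_neg_geom_sum]
  have h : ∑ j ∈ range n, q ^ n ≤ ∑ j ∈ range n, q ^ j :=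
    Finset.sum_le_sum fun j hj => pow_le_pow_of_le_one hq0 hq1 (mem_range.1 hj).le
  rw [Finset.sum_const, Finset.card_range, nsmul_eq_mul] at h
  calc _ = (1 - q) * (n * q ^ n) := by ring
    _ ≤ _ := mul_le_mul_of_nonneg_left h (by linarith)

/-- A supporting line of the concave sequence `1 - q ^ i` at `i = n`. -/
theorem one_sub_pow_le_line {q : ℝ} (hq0 : 0 ≤ q) (hq1 : q ≤ 1) (n i : ℕ) :
    1 - q ^ i ≤ (1 - q ^ n - (1 - q) * q ^ n * n) + (1 - q) * q ^ n * i := by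
  rcases le_total n i with h | h
  · obtain ⟨m, rfl⟩ := Nat.exists_eq_add_of_le h
    have h1 := mul_le_mul_of_nonneg_left (one_sub_pow_le hq0 m) (pow_nonneg hq0 n)
    rw [pow_add]
    push_cast
    linarith
  · obtain ⟨m, rfl⟩ := Nat.exists_eq_add_of_le h
    have h1 := mul_le_mul_of_nonneg_left (le_one_sub_pow hq0 hq1 m) (pow_nonneg hq0 i)
    rw [pow_add]
    push_cast
    linarith

theorem hasSum_two_point (f : ℕ+ → ℝ) (m : ℕ+) (x y : ℝ) :
    HasSum (fun i => f i * ((if i = m then x else 0) + (if i = m + 1 then y else 0)))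
      (f m * x + f (m + 1) * y) := by
  have h := (hasSum_ite_eq m (f m * x)).add (hasSum_ite_eq (m + 1) (f (m + 1) * y))
  convert h using 2 with i
  rw [mul_add]
  congr 1
  · split_ifs with hi
    · rw [hi]
    · simp
  · split_ifs with hi
    · rw [hi]
    · simp

theorem bddBelow_lp_values {δ k : ℝ} (hk : 0 < k) :
    BddBelow ((fun β : ℕ+ → ℝ => 1 / k * ∑' i : ℕ+, β i) '' lpFeasible δ k) := by
  refine ⟨0, ?_⟩
  rintro _ ⟨β, hβ, rfl⟩
  exact mul_nonneg (by positivity) (tsum_nonneg hβ.1)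

/-- The feasible point splits the total mass `∑ i βᵢ = k` into a fraction `1 - s` at the index `m`
and `s` at `m + 1`. -/
theorem mem_lp_values_of_two_point {δ k s : ℝ} {m : ℕ} (hk : 1 < k) (hm : 1 ≤ m) (hs0 : 0 ≤ s)
    (hs1 : s ≤ 1)
    (h : δ ≤ (1 - (1 - 1 / k) ^ m) * ((1 - s) * k / m) +
      (1 - (1 - 1 / k) ^ (m + 1)) * (s * k / (m + 1))) :
    (1 - s) / m + s / (m + 1) ∈
      (fun β : ℕ+ → ℝ => 1 / k * ∑' i : ℕ+, β i) '' lpFeasible δ k := by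
  obtain ⟨M, rfl⟩ : ∃ M : ℕ+, (M : ℕ) = m := ⟨⟨m, hm⟩, rfl⟩
  have hM : (0 : ℝ) < (M : ℕ) := by exact_mod_cast M.pos
  refine ⟨fun i => (if i = M then (1 - s) * k / (M : ℕ) else 0) +
    (if i = M + 1 then s * k / ((M : ℕ) + 1) else 0), ⟨?_, ?_, ?_⟩, ?_⟩
  · intro i
    have h1 : 0 ≤ (1 - s) * k / (M : ℕ) :=
      div_nonneg (mul_nonneg (by linarith) (by linarith)) hM.le
    have h2 : 0 ≤ s * k / ((M : ℕ) + 1) := by positivity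
    dsimp only
    split_ifs <;> linarith
  · have := hasSum_two_point (fun i => ((i : ℕ) : ℝ)) M ((1 - s) * k / (M : ℕ))
      (s * k / ((M : ℕ) + 1))
    convert this using 1
    push_cast
    field_simp
    ring
  · have := hasSum_two_point (fun i => 1 - (1 - 1 / k) ^ (i : ℕ)) M ((1 - s) * k / (M : ℕ))
      (s * k / ((M : ℕ) + 1))
    rw [this.tsum_eq]
    simpa using h
  · have := hasSum_two_point (fun _ => 1) M ((1 - s) * k / (M : ℕ)) (s * k / ((M : ℕ) + 1))
    simp only [one_mul] at this
    dsimp only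
    rw [this.tsum_eq]
    field_simp

/-- Weak duality: summing the supporting line at `n` against `β` gives `δ ≤ A ∑ βᵢ + b k`. The bound
is arranged so that its excess over `1/n` has the sign of `δ n - ∑ q ^ j`. -/
theorem one_div_add_le_sizeExpansion {δ k : ℝ} {n : ℕ} (hk : 1 < k) (hδ1 : δ ≤ 1) (hn : 1 ≤ n) :
    ∃ a : ℝ, 0 < a ∧
      1 / n + a * (δ * n - ∑ j ∈ range n, (1 - 1 / k) ^ j) ≤ sizeExpansion δ k := by
  set q : ℝ := 1 - 1 / k with hq
  have hk0 : 0 < k := by linarith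
  have hk1 : 1 / k < 1 := by rw [div_lt_one hk0]; exact hk
  have hk2 : 0 < 1 / k := by positivity
  have hq0 : 0 < q := by rw [hq]; linarith
  have hq1 : q < 1 := by rw [hq]; linarith
  have hn0 : (0 : ℝ) < n := by exact_mod_cast hn
  set b : ℝ := (1 - q) * q ^ n with hb
  set A : ℝ := 1 - q ^ n - b * n with hA
  have hA0 : 0 < A := by
    have h1 : ∑ j ∈ range n, q ^ n < ∑ j ∈ range n, q ^ j :=
      Finset.sum_lt_sum_of_nonempty (by simpa using (by omega : n ≠ 0))
        fun j hj => pow_lt_pow_right_of_lt_one₀ hq0 hq1 (mem_range.1 hj)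
    rw [Finset.sum_const, Finset.card_range, nsmul_eq_mul] at h1
    have h2 := mul_lt_mul_of_pos_left h1 (sub_pos.2 hq1)
    rw [mul_neg_geom_sum] at h2
    rw [hA, hb]
    linarith
  refine ⟨1 / (n * A * k), by positivity, ?_⟩
  refine le_csInf ?_ ?_
  -- A lower bound on the infimum needs a feasible point: `β₁ = k`, feasible because `δ ≤ 1`.
  · refine ⟨_, mem_lp_values_of_two_point (m := 1) (s := 0) hk le_rfl le_rfl zero_le_one ?_⟩
    norm_num
    rw [inv_mul_cancel₀ hk0.ne']
    exact hδ1
  · rintro _ ⟨β, ⟨hβ0, hβk, hβδ⟩, rfl⟩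
    have hsum : Summable β := by
      refine Summable.of_nonneg_of_le hβ0 (fun i => ?_) hβk.summable
      have h1 : (1 : ℝ) ≤ ((i : ℕ) : ℝ) := by exact_mod_cast i.pos
      have := hβ0 i
      nlinarith
    have hline : ∀ i : ℕ+, (1 - q ^ (i : ℕ)) * β i ≤ A * β i + b * (((i : ℕ) : ℝ) * β i) := by
      intro i
      have := mul_le_mul_of_nonneg_right (one_sub_pow_le_line hq0.le hq1.le n i) (hβ0 i)
      rw [hA, hb]
      linarith
    have hR : HasSum (fun i : ℕ+ => A * β i + b * (((i : ℕ) : ℝ) * β i))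
        (A * ∑' i, β i + b * k) := (hsum.hasSum.mul_left A).add (hβk.mul_left b)
    have hLs : Summable fun i : ℕ+ => (1 - q ^ (i : ℕ)) * β i := by
      refine Summable.of_nonneg_of_le (fun i => mul_nonneg ?_ (hβ0 i)) hline hR.summable
      rw [sub_nonneg]
      exact pow_le_one₀ hq0.le hq1.le
    have h1 : δ ≤ A * ∑' i, β i + b * k :=
      hβδ.trans (hasSum_le hline hLs.hasSum hR)
    rw [← mul_one_sub_pow_eq_sum hk, ← hq]
    have h2 : 1 / (n : ℝ) + 1 / (n * A * k) * (δ * n - k * (1 - q ^ n)) =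
        (δ - b * k) / (A * k) := by
      have : 1 - q ^ n = A + b * n := by rw [hA]; ring
      rw [this]
      field_simp
      ring
    rw [h2, div_le_iff₀ (by positivity)]
    calc δ - b * k ≤ A * ∑' i, β i := by linarith
      _ = _ := by field_simp

theorem sizeExpansion_eq_of_sum_eq {δ k : ℝ} {n : ℕ} (hk : 1 < k) (hδ1 : δ ≤ 1) (hn : 1 ≤ n)
    (h : ∑ j ∈ range n, (1 - 1 / k) ^ j = δ * n) : sizeExpansion δ k = 1 / n := by
  have hn0 : (0 : ℝ) < n := by exact_mod_cast hn
  refine le_antisymm ?_ ?_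
  · have h1 := mem_lp_values_of_two_point (δ := δ) (k := k) (s := 0) (m := n) hk hn le_rfl
      zero_le_one (by
        rw [← mul_one_sub_pow_eq_sum hk] at h
        refine le_of_eq ?_
        calc δ = δ * n / n := by field_simp
          _ = _ := by rw [← h]; ring)
    have h2 : sizeExpansion δ k ≤ (1 - 0) / n + 0 / (n + 1) :=
      csInf_le (bddBelow_lp_values (by linarith)) h1
    simpa using h2
  · obtain ⟨a, _, ha⟩ := one_div_add_le_sizeExpansion (δ := δ) hk hδ1 hn
    rw [h, sub_self, mul_zero, add_zero] at ha
    exact ha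

theorem sum_eq_of_sizeExpansion_eq {δ k : ℝ} {n : ℕ} (hk : 1 < k) (hδ0 : 0 < δ) (hδ1 : δ ≤ 1)
    (hn : 1 ≤ n) (h : sizeExpansion δ k = 1 / n) :
    ∑ j ∈ range n, (1 - 1 / k) ^ j = δ * n := by
  have hn0 : (0 : ℝ) < n := by exact_mod_cast hn
  have hk0 : 0 < k := by linarith
  rcases lt_trichotomy (∑ j ∈ range n, (1 - 1 / k) ^ j) (δ * n) with hlt | heq | hgt
  · obtain ⟨a, ha0, ha⟩ := one_div_add_le_sizeExpansion (δ := δ) hk hδ1 hn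
    have := mul_pos ha0 (sub_pos.2 hlt)
    linarith
  · exact heq
  · exfalso
    set W := ∑ j ∈ range n, (1 - 1 / k) ^ j with hW
    have hW0 : 0 < W := lt_trans (by positivity) hgt
    have hs1 : δ * n / W < 1 := by rw [div_lt_one hW0]; exact hgt
    have hs0 : 0 < δ * n / W := by positivity
    -- The fraction `δ n / W` at `n` alone meets the constraint; moving the rest to `n + 1` lowers
    -- the value strictly below `1/n`.
    have h1 := mem_lp_values_of_two_point (δ := δ) (k := k) (s := 1 - δ * n / W) (m := n) hk hn
      (by linarith) (by linarith) (by
        have hnn : 0 ≤ (1 - (1 - 1 / k) ^ (n + 1)) * ((1 - δ * n / W) * k / (n + 1)) := by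
          refine mul_nonneg ?_ (div_nonneg (mul_nonneg (by linarith) hk0.le) (by positivity))
          rw [sub_nonneg]
          have hk1 : 1 / k < 1 := by rw [div_lt_one hk0]; exact hk
          have hk2 : 0 < 1 / k := by positivity
          exact pow_le_one₀ (by linarith) (by linarith)
        have h2 : (1 - (1 - 1 / k) ^ n) * ((1 - (1 - δ * n / W)) * k / n) = δ := by
          calc _ = (k * (1 - (1 - 1 / k) ^ n)) * (δ / W) := by field_simp; ring
            _ = δ := by rw [mul_one_sub_pow_eq_sum hk, ← hW]; field_simp
        linarith)
    have h2 := csInf_le (bddBelow_lp_values hk0) h1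
    have h3 : sizeExpansion δ k ≤
      (1 - (1 - δ * n / W)) / n + (1 - δ * n / W) / (n + 1) := h2
    rw [h] at h3
    have h4 : (1 - δ * n / W) / (n + 1) < (1 - δ * n / W) / n :=
      div_lt_div_of_pos_left (by linarith) hn0 (by linarith)
    have h5 : (1 - (1 - δ * n / W)) / n + (1 - δ * n / W) / n = 1 / (n : ℝ) := by
      rw [← add_div]; congr 1; ring
    linarith

theorem sum_pow_lt_sum_pow {k k' : ℝ} {n : ℕ} (hk : 1 < k) (hkk : k < k') (hn : 2 ≤ n) :
    ∑ j ∈ range n, (1 - 1 / k) ^ j < ∑ j ∈ range n, (1 - 1 / k') ^ j := by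
  have hk0 : 0 < k := by linarith
  have hk1 : 1 / k < 1 := by rw [div_lt_one hk0]; exact hk
  have hlt : 1 - 1 / k < 1 - 1 / k' := by
    have := one_div_lt_one_div_of_lt hk0 hkk
    linarith
  refine Finset.sum_lt_sum (fun j _ => pow_le_pow_left₀ (by linarith) hlt.le j)
    ⟨1, mem_range.2 (by omega), by simpa using hlt⟩

/-- By Bernoulli, each term is at least `1 - j / k ≥ δ`. This serves both as the upper end for the
intermediate value theorem and as the expansion condition for the sparse filler copies. -/
theorem mul_le_sum_pow {δ k : ℝ} {n : ℕ} (hδ : δ < 1) (hk : 1 ≤ k) (hnk : n / (1 - δ) ≤ k) :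
    δ * n ≤ ∑ j ∈ range n, (1 - 1 / k) ^ j := by
  have hk0 : 0 < k := by linarith
  have hk1 : 1 / k ≤ 1 := by rw [div_le_one hk0]; exact hk
  have h : ∑ j ∈ range n, δ ≤ ∑ j ∈ range n, (1 - 1 / k) ^ j := by
    refine Finset.sum_le_sum fun j hj => ?_
    have h1 := one_sub_pow_le (q := 1 - 1 / k) (by linarith) j
    have h2 : (j : ℝ) ≤ n := by exact_mod_cast (mem_range.1 hj).le
    rw [div_le_iff₀ (by linarith)] at hnk
    have h3 : (j : ℝ) * (1 - (1 - 1 / k)) ≤ 1 - δ := by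
      rw [sub_sub_cancel, mul_one_div, div_le_iff₀ hk0]
      linarith
    linarith
  rw [Finset.sum_const, Finset.card_range, nsmul_eq_mul] at h
  linarith

theorem exists_sum_pow_eq {δ : ℝ} {n : ℕ} (hδ0 : 0 < δ) (hδ : δ < 1) (hδn : 1 < δ * n) :
    ∃ k : ℝ, 1 < k ∧ ∑ j ∈ range n, (1 - 1 / k) ^ j = δ * n := by
  have hn : 1 ≤ n := by
    rcases Nat.eq_zero_or_pos n with h | h
    · subst h; norm_num at hδn
    · exact h
  have hS1 : ∑ j ∈ range n, (1 - 1 / (1 : ℝ)) ^ j = 1 := by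
    rw [Finset.sum_eq_single_of_mem 0 (by simpa using (by omega : 0 < n))]
    · simp
    · intro j _ hj
      simp [hj]
  have hK : (1 : ℝ) ≤ n / (1 - δ) := by
    rw [le_div_iff₀ (by linarith)]
    have : (1 : ℝ) ≤ n := by exact_mod_cast hn
    linarith
  have hcont : ContinuousOn (fun k : ℝ => ∑ j ∈ range n, (1 - 1 / k) ^ j)
      (Set.Icc 1 (n / (1 - δ))) := by
    refine continuousOn_finsetSum _ fun j _ => ContinuousOn.pow ?_ j
    refine continuousOn_const.sub (continuousOn_const.div continuousOn_id fun x hx => ?_)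
    have : (1 : ℝ) ≤ x := hx.1
    exact (by linarith : (0 : ℝ) < x).ne'
  obtain ⟨k, hk, hk'⟩ := intermediate_value_Icc hK hcont
    (show δ * n ∈ Set.Icc _ _ from ⟨by rw [hS1]; exact hδn.le, mul_le_sum_pow hδ hK le_rfl⟩)
  refine ⟨k, lt_of_le_of_ne hk.1 ?_, hk'⟩
  rintro rfl
  dsimp only at hk'
  rw [hS1] at hk'
  linarith

end LinearProgram

/-! ### From a balanced vertex set to a Tanner codeword. -/

section Tanner

theorem exists_mem_card_support_eq {d d₀ : ℕ} {C₀ : Submodule (ZMod 2) (Fin d → ZMod 2)}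
    (h : minDist C₀ = (d₀ : ℕ∞)) :
    ∃ w ∈ C₀, (univ.filter fun i => w i ≠ 0).card = d₀ := by
  -- The strict bound extracts a pair of codewords from the infimum, which integrality then places
  -- at distance exactly `d₀`.
  have h1 : minDist C₀ < (d₀ + 1 : ℕ) := by rw [h]; exact_mod_cast Nat.lt_succ_self d₀
  have hle : ∀ x ∈ C₀, ∀ y ∈ C₀, x ≠ y → minDist C₀ ≤ hammingDist x y := fun x hx y hy hxy =>
    iInf₂_le_of_le x hx (iInf₂_le_of_le y hy (iInf_le_of_le hxy le_rfl))
  simp only [minDist, iInf_lt_iff] at h1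
  obtain ⟨x, hx, y, hy, hxy, hlt⟩ := h1
  have h2 := hle x hx y hy hxy
  rw [h] at h2
  have h3 : d₀ ≤ hammingDist x y := by exact_mod_cast h2
  have h4 : hammingDist x y < d₀ + 1 := by exact_mod_cast hlt
  refine ⟨x - y, C₀.sub_mem hx hy, ?_⟩
  have h5 : (univ.filter fun i => (x - y) i ≠ 0).card = hammingDist x y := by
    simp [hammingDist, sub_eq_zero]
  omega

theorem exists_minDist_le {ι : Type*} [Fintype ι] {C : Submodule (ZMod 2) (ι → ZMod 2)}
    {x : ι → ZMod 2} (hx : x ∈ C) (hx0 : x ≠ 0) :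
    ∃ D : ℕ, minDist C = (D : ℕ∞) ∧ D ≤ hammingNorm x := by
  have h : minDist C ≤ hammingNorm x := by
    refine iInf₂_le_of_le x hx (iInf₂_le_of_le 0 C.zero_mem (iInf_le_of_le hx0 ?_))
    simp
  obtain ⟨D, hD⟩ := ENat.ne_top_iff_exists.1 (ne_top_of_le_ne_top (ENat.natCast_ne_top _) h)
  exact ⟨D, hD.symm, by rw [← hD] at h; exact_mod_cast h⟩

/-- Two subsets of the same size of two types of the same size are matched by an equivalence. -/
theorem exists_equiv_forall_iff {A B : Type*} [Fintype A] [Fintype B] (p : A → Prop)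
    (q : B → Prop) [DecidablePred p] [DecidablePred q] (hAB : Fintype.card A = Fintype.card B)
    (hpq : (univ.filter p).card = (univ.filter q).card) : ∃ e : A ≃ B, ∀ a, q (e a) ↔ p a := by
  have h1 : Fintype.card {a // p a} = Fintype.card {b // q b} := by
    rw [Fintype.card_subtype, Fintype.card_subtype, hpq]
  have h2 : Fintype.card {a // ¬p a} = Fintype.card {b // ¬q b} := by
    rw [Fintype.card_subtype_compl, Fintype.card_subtype_compl, hAB, h1]
  let e1 := Fintype.equivOfCardEq h1
  let e2 := Fintype.equivOfCardEq h2
  refine ⟨(Equiv.sumCompl p).symm.trans ((Equiv.sumCongr e1 e2).trans (Equiv.sumCompl q)),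
    fun a => ?_⟩
  by_cases ha : p a
  · simp [Equiv.sumCompl_symm_apply_of_pos ha, ha, (e1 ⟨a, ha⟩).2]
  · simp [Equiv.sumCompl_symm_apply_of_neg ha, ha, (e2 ⟨a, ha⟩).2]

/-- The indicator of `S` is made a codeword: where `S` meets `N(v)` in `d₀` vertices, the ordering
puts them on the support of a weight-`d₀` word of `C₀`, and over `ZMod 2` equal supports mean equal
words. -/
theorem exists_ordering_minDist_le {L R : Type*} [Fintype L] [DecidableEq L] [DecidableEq R]
    {E : Finset (L × R)} {d d₀ : ℕ}
    (hreg : ∀ v : R, (rightNbrs E v).card = d) {S : Finset L} (hS : S.Nonempty)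
    (hSd : ∀ v : R, ((rightNbrs E v).filter (· ∈ S)).card = d₀ ∨
      ((rightNbrs E v).filter (· ∈ S)).card = 0)
    {C₀ : Submodule (ZMod 2) (Fin d → ZMod 2)} (hC₀ : minDist C₀ = (d₀ : ℕ∞)) :
    ∃ σ : NbrOrdering E d, ∃ D : ℕ, minDist (tannerCode E σ C₀) = (D : ℕ∞) ∧ D ≤ S.card := by
  obtain ⟨w, hw, hwd⟩ := exists_mem_card_support_eq hC₀
  let x : L → ZMod 2 := fun u => if u ∈ S then 1 else 0
  have hσ : ∀ v : R, ∃ e : Fin d ≃ {u : L // u ∈ rightNbrs E v}, (fun i => x (e i)) ∈ C₀ := by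
    intro v
    have hcard : Fintype.card (Fin d) = Fintype.card {u : L // u ∈ rightNbrs E v} := by
      simp [hreg v]
    have hsub : (univ.filter fun u : {u : L // u ∈ rightNbrs E v} => u.1 ∈ S).card =
        ((rightNbrs E v).filter (· ∈ S)).card := by
      refine Finset.card_bij (fun u _ => u.1) ?_ ?_ ?_
      · intro u hu
        simpa [u.2] using hu
      · intro u _ u' _ h
        exact Subtype.ext h
      · intro u hu
        rw [mem_filter] at hu
        exact ⟨⟨u, hu.1⟩, by simpa using hu.2, rfl⟩
    rcases hSd v with h | h
    · obtain ⟨e, he⟩ := exists_equiv_forall_iff (fun i => w i ≠ 0)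
        (fun u : {u : L // u ∈ rightNbrs E v} => u.1 ∈ S) hcard (by rw [hwd, hsub, h])
      refine ⟨e, ?_⟩
      convert hw using 2 with i
      have h01 : ∀ y : ZMod 2, y ≠ 0 → y = 1 := by decide
      by_cases hi : w i = 0
      · have : (e i).1 ∉ S := fun hc => (he i).1 hc hi
        simp [x, this, hi]
      · have : (e i).1 ∈ S := (he i).2 hi
        simp [x, this, h01 _ hi]
    · refine ⟨Fintype.equivOfCardEq hcard, ?_⟩
      convert C₀.zero_mem using 2 with i
      rw [Finset.card_eq_zero, Finset.filter_eq_empty_iff] at h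
      simp [x, h (Fintype.equivOfCardEq hcard i).2]
  choose σ hσ using hσ
  obtain ⟨u, hu⟩ := hS
  obtain ⟨D, hD, hDle⟩ := exists_minDist_le (C := tannerCode E σ C₀) (x := x) hσ (by
    intro h
    have := congrFun h u
    simp [x, hu] at this)
  refine ⟨σ, D, hD, hDle.trans (le_of_eq ?_)⟩
  simp [hammingNorm, x]

end Tanner

/-! ### Layered maps as bipartite graphs. -/

section Layered

/-- A layered graph: in layer `j` the left vertex `u` is joined to the right vertex `(j, φ j u)`. -/
theorem exists_fin_graph {L P : Type*} [Fintype L] [DecidableEq L] [Fintype P] [DecidableEq P]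
    {c d d₀ : ℕ} {α η : ℝ} (φ : Fin c → L → P) (S : Finset L)
    (hfib : ∀ j p, (univ.filter fun u => φ j u = p).card = d ∨
      (univ.filter fun u => φ j u = p).card = 0)
    (hS : ∀ j p, (univ.filter fun u => φ j u = p ∧ u ∈ S).card = d₀ ∨
      (univ.filter fun u => φ j u = p ∧ u ∈ S).card = 0)
    (hexp : ∀ T : Finset L, (T.card : ℝ) ≤ α * (Fintype.card L : ℝ) →
      η * c * T.card ≤ ∑ j, ((T.image (φ j)).card : ℝ)) :
    ∃ (m : ℕ) (E : Finset (Fin (Fintype.card L) × Fin m)), IsBipartiteExpander E c d α η ∧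
      ∃ S' : Finset (Fin (Fintype.card L)), S'.card = S.card ∧
        ∀ v, ((rightNbrs E v).filter (· ∈ S')).card = d₀ ∨
          ((rightNbrs E v).filter (· ∈ S')).card = 0 := by
  classical
  let eL : L ≃ Fin (Fintype.card L) := Fintype.equivFin L
  -- Labels with empty fibres are discarded, so every right vertex has degree exactly `d`; keeping
  -- the layer in the label prevents multiple edges.
  let eR : {r : Fin c × P // ∃ u, φ r.1 u = r.2} ≃ Fin (Fintype.card _) := Fintype.equivFin _
  let E : Finset (Fin (Fintype.card L) × Fin (Fintype.card _)) :=
    univ.filter fun x => φ (eR.symm x.2).1.1 (eL.symm x.1) = (eR.symm x.2).1.2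
  refine ⟨_, E, ⟨?_, ?_, ?_⟩, S.map eL.toEmbedding, by simp, ?_⟩
  · intro u
    conv_rhs => rw [← Fintype.card_fin c, ← Finset.card_univ]
    symm
    refine Finset.card_bij (fun j _ => eR ⟨(j, φ j (eL.symm u)), ⟨_, rfl⟩⟩) ?_ ?_ ?_
    · intro j _
      simp [leftNbrs, E]
    · intro j _ j' _ h
      have := congrArg (fun r => r.1.1) (eR.injective h)
      exact this
    · intro v hv
      simp only [leftNbrs, E, mem_filter, mem_univ, true_and] at hv
      refine ⟨(eR.symm v).1.1, mem_univ _, ?_⟩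
      rw [← Equiv.eq_symm_apply]
      refine Subtype.ext (Prod.ext rfl ?_)
      exact hv
  · intro v
    obtain ⟨r, rfl⟩ := eR.surjective v
    have h : (rightNbrs E (eR r)).card = (univ.filter fun u => φ r.1.1 u = r.1.2).card := by
      refine Finset.card_bij' (fun u _ => eL.symm u) (fun u _ => eL u) ?_ ?_ ?_ ?_ <;>
        simp [rightNbrs, E]
    rw [h]
    refine (hfib r.1.1 r.1.2).resolve_right ?_
    obtain ⟨u, hu⟩ := r.2
    exact Finset.card_ne_zero.2 ⟨u, by simpa using hu⟩
  · intro T hT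
    have h1 := hexp (T.map eL.symm.toEmbedding) (by
      rw [Finset.card_map]; simpa using hT)
    rw [Finset.card_map] at h1
    refine h1.trans ?_
    rw [← Nat.cast_sum, ← Finset.card_sigma]
    refine Nat.cast_le.2 (Finset.card_le_card_of_surjOn
      (fun v => ⟨(eR.symm v).1.1, (eR.symm v).1.2⟩) ?_)
    rintro ⟨j, p⟩ hp
    simp only [Finset.coe_sigma, Set.mem_sigma_iff, mem_coe, mem_univ, true_and, mem_image,
      mem_map_equiv, Equiv.symm_symm] at hp
    obtain ⟨u, hu, rfl⟩ := hp
    refine ⟨eR ⟨(j, φ j u), ⟨_, rfl⟩⟩, ?_, by simp⟩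
    simp only [nbrs, E, mem_coe, mem_filter, mem_univ, true_and]
    exact ⟨eL u, hu, by simp⟩
  · intro v
    obtain ⟨r, rfl⟩ := eR.surjective v
    have h : ((rightNbrs E (eR r)).filter (· ∈ S.map eL.toEmbedding)).card =
        (univ.filter fun u => φ r.1.1 u = r.1.2 ∧ u ∈ S).card := by
      refine Finset.card_bij' (fun u _ => eL.symm u) (fun u _ => eL u) ?_ ?_ ?_ ?_ <;>
        simp [rightNbrs, E]
    rw [h]
    exact hS _ _

end Layered

/-! ### The codeword part, its fillers and the expansion of their union. -/

section Construction

variable {a b c d d₀ Q : ℕ}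

/-- The layers of the final graph. The left vertices are a set of `a d d₀` vertices (the future
codeword) and `c` copies of a set of `a Q d` vertices; each part is split by permutations into
blocks. In layer `j`, the `j`-th copy is split trivially, and some of its blocks are dissolved
to complete the blocks of the first part from size `d₀` to size `d`. -/
def layerMap (d₀ : ℕ) (π : Fin c → Equiv.Perm ((Fin a × Fin d) × Fin d₀))
    (ρ : Fin c → Equiv.Perm ((Fin a × Fin Q) × Fin d)) (j : Fin c) :
    ((Fin a × Fin d) × Fin d₀) ⊕ (Fin c × ((Fin a × Fin Q) × Fin d)) →
      (Fin a × Fin d) ⊕ (Fin c × (Fin a × Fin Q))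
  | Sum.inl x => Sum.inl (π j x).1
  | Sum.inr (i, y) =>
    if i = j then
      if y.1.2.val < d - d₀ then Sum.inl (y.1.1, y.2) else Sum.inr (i, y.1)
    else Sum.inr (i, (ρ j y).1)

variable (π : Fin c → Equiv.Perm ((Fin a × Fin d) × Fin d₀))
  (ρ : Fin c → Equiv.Perm ((Fin a × Fin Q) × Fin d))

theorem card_filter_perm_fst_eq {P : Type*} [Fintype P] [DecidableEq P] {b : ℕ}
    (π : Equiv.Perm (P × Fin b)) (p : P) : (univ.filter fun x => (π x).1 = p).card = b := by
  have h : (univ.filter fun x => (π x).1 = p).card = (univ : Finset (Fin b)).card := by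
    refine Finset.card_bij' (fun x _ => (π x).2) (fun i _ => π.symm (p, i)) ?_ ?_ ?_ ?_
    · simp
    · simp
    · intro x hx
      rw [mem_filter] at hx
      rw [← hx.2]
      simp
    · simp
  simpa using h

/-- Each dissolved block `(x, l)` of copy `j` gives one vertex to each `(x, z)`. There are `d - d₀`
such `l` for each `x`, available because `d ≤ Q`, so each block of size `d₀` is completed to size
`d`. -/
theorem card_filter_layerMap (hd : d₀ ≤ d) (hQ : d ≤ Q) (j : Fin c)
    (p : (Fin a × Fin d) ⊕ (Fin c × (Fin a × Fin Q))) :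
    (univ.filter fun u => layerMap d₀ π ρ j u = p).card = d ∨
      (univ.filter fun u => layerMap d₀ π ρ j u = p).card = 0 := by
  classical
  have hsplit : (univ.filter fun u => layerMap d₀ π ρ j u = p).card =
      (univ.filter fun x => layerMap d₀ π ρ j (Sum.inl x) = p).card +
        (univ.filter fun y => layerMap d₀ π ρ j (Sum.inr y) = p).card := by
    simp only [Finset.card_filter, Fintype.sum_sum_type]
  rw [hsplit]
  rcases p with ⟨x, z⟩ | ⟨i, x, l⟩
  · left
    have h1 : (univ.filter fun u => layerMap d₀ π ρ j (Sum.inl u) = Sum.inl (x, z)).card = d₀ := by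
      simp only [layerMap, Sum.inl.injEq]
      exact card_filter_perm_fst_eq (π j) (x, z)
    have h2 : (univ.filter fun u => layerMap d₀ π ρ j (Sum.inr u) = Sum.inl (x, z)).card =
        (univ : Finset (Fin (d - d₀))).card := by
      symm
      refine Finset.card_bij
        (fun l _ => (j, ((x, ⟨l.1, by have := l.2; omega⟩), z))) ?_ ?_ ?_
      · intro l _
        rw [mem_filter]
        simp [layerMap, l.2]
      · intro l _ l' _ h
        simpa [Fin.ext_iff] using h
      · rintro ⟨i, ⟨x', l⟩, z'⟩ h
        rw [mem_filter] at h
        replace h := h.2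
        simp only [layerMap] at h
        split_ifs at h with h3 h4
        simp only [Sum.inl.injEq, Prod.mk.injEq] at h
        refine ⟨⟨l.1, h4⟩, mem_univ _, ?_⟩
        rw [h3, h.1, h.2]
    rw [h1, h2, Finset.card_univ, Fintype.card_fin]
    omega
  · have h1 : (univ.filter fun u => layerMap d₀ π ρ j (Sum.inl u) = Sum.inr (i, x, l)).card =
        0 := by
      simp [layerMap]
    rw [h1, zero_add]
    by_cases hij : i = j
    · subst hij
      by_cases hl : l.val < d - d₀
      · right
        rw [Finset.card_eq_zero, Finset.filter_eq_empty_iff]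
        rintro ⟨i', ⟨x', l'⟩, z'⟩ _ h
        simp only [layerMap] at h
        split_ifs at h with h3 h4
        · simp only [Sum.inr.injEq, Prod.mk.injEq] at h
          rw [h.2.2] at h4
          exact h4 hl
        · simp only [Sum.inr.injEq, Prod.mk.injEq] at h
          exact h3 h.1
      · left
        have h2 : (univ.filter fun u => layerMap d₀ π ρ i (Sum.inr u) =
            Sum.inr (i, x, l)).card = (univ : Finset (Fin d)).card := by
          symm
          refine Finset.card_bij (fun z _ => (i, ((x, l), z))) ?_ ?_ ?_
          · intro z _
            rw [mem_filter]
            simp [layerMap, hl]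
          · intro z _ z' _ h
            simpa using h
          · rintro ⟨i', ⟨x', l'⟩, z'⟩ h
            rw [mem_filter] at h
            replace h := h.2
            simp only [layerMap] at h
            split_ifs at h with h3 h4
            · simp only [Sum.inr.injEq, Prod.mk.injEq] at h
              refine ⟨z', mem_univ _, ?_⟩
              rw [h.1, h.2.1, h.2.2]
            · simp only [Sum.inr.injEq, Prod.mk.injEq] at h
              exact absurd h.1 h3
        rw [h2, Finset.card_univ, Fintype.card_fin]
    · left
      refine Eq.trans (Eq.symm ?_) (card_filter_perm_fst_eq (ρ j) (x, l))
      refine Finset.card_bij (fun y _ => (i, y)) ?_ ?_ ?_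
      · intro y hy
        rw [mem_filter] at hy ⊢
        simpa [layerMap, hij] using hy
      · intro y _ y' _ h
        simpa using h
      · rintro ⟨i', y⟩ h
        rw [mem_filter] at h
        replace h := h.2
        simp only [layerMap] at h
        split_ifs at h with h3 h4
        · simp only [Sum.inr.injEq, Prod.mk.injEq] at h
          exact absurd (h.1.symm.trans h3) hij
        · simp only [Sum.inr.injEq, Prod.mk.injEq] at h
          refine ⟨y, ?_, by rw [h.1]⟩
          simp [h.2]

theorem card_filter_layerMap_inl (j : Fin c) (p : (Fin a × Fin d) ⊕ (Fin c × (Fin a × Fin Q))) :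
    (univ.filter fun u => layerMap d₀ π ρ j u = p ∧ u ∈ univ.map Function.Embedding.inl).card =
        d₀ ∨
      (univ.filter fun u => layerMap d₀ π ρ j u = p ∧
        u ∈ univ.map Function.Embedding.inl).card = 0 := by
  classical
  have hsplit : (univ.filter fun u => layerMap d₀ π ρ j u = p ∧
      u ∈ univ.map Function.Embedding.inl).card =
      (univ.filter fun x => layerMap d₀ π ρ j (Sum.inl x) = p).card := by
    simp only [Finset.card_filter, Fintype.sum_sum_type]
    simp
  rw [hsplit]
  rcases p with p | p
  · left
    simp only [layerMap, Sum.inl.injEq]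
    exact card_filter_perm_fst_eq (π j) p
  · right
    simp [layerMap]

/-- Copy `j` is ignored in layer `j`, where its dissolved vertices may share labels with the first
part; the other copies use labels disjoint from it and from one another. -/
theorem le_card_image_layerMap (j : Fin c)
    (T : Finset (((Fin a × Fin d) × Fin d₀) ⊕ (Fin c × ((Fin a × Fin Q) × Fin d)))) :
    (T.toLeft.image fun x => (π j x).1).card +
      ∑ i ∈ univ.erase j, ((univ.filter fun y => (i, y) ∈ T.toRight).image
        fun y => (ρ j y).1).card ≤ (T.image (layerMap d₀ π ρ j)).card := by
  classical
  rw [← Finset.card_sigma, ← Finset.card_disjSum]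
  refine Finset.card_le_card_of_injOn
    (Sum.map id fun x : (_ : Fin c) × (Fin a × Fin Q) => (x.1, x.2)) ?_ ?_
  · rintro (p | ⟨i, p⟩) h
    · simp only [mem_coe, inl_mem_disjSum, mem_image, mem_toLeft] at h
      obtain ⟨x, hx, rfl⟩ := h
      exact mem_coe.2 (mem_image.2 ⟨_, hx, rfl⟩)
    · simp only [mem_coe, inr_mem_disjSum, mem_sigma, mem_erase, mem_image, mem_filter, mem_univ,
        true_and, and_true, mem_toRight] at h
      obtain ⟨hij, y, hy, rfl⟩ := h
      exact mem_coe.2 (mem_image.2 ⟨_, hy, by simp [layerMap, hij]⟩)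
  · refine Set.injOn_of_injective (Function.Injective.sumMap Function.injective_id ?_)
    rintro ⟨i, x⟩ ⟨i', x'⟩ h
    simp only [Prod.mk.injEq] at h
    obtain ⟨rfl, rfl⟩ := h
    rfl

theorem card_eq_sum_parts
    (T : Finset (((Fin a × Fin d) × Fin d₀) ⊕ (Fin c × ((Fin a × Fin Q) × Fin d)))) :
    T.card = T.toLeft.card +
      ∑ i, (univ.filter fun y => (i, y) ∈ T.toRight).card := by
  rw [← Finset.card_toLeft_add_card_toRight]
  congr 1
  have h : T.toRight.card = ∑ u, if u ∈ T.toRight then 1 else 0 := by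
    rw [Finset.sum_boole, Finset.filter_univ_mem, Nat.cast_id]
  rw [h, Fintype.sum_prod_type]
  simp only [Finset.card_filter]

/-- Ignoring copy `j` in layer `j` loses at most the number of vertices of `T` in that copy. Over
all layers this is at most `|T|`, which the gap of `1` between `η c` and `η' c` pays for. -/
theorem expansion_layerMap {η η' : ℝ} (hη : η' * c ≤ η * c - 1)
    (T : Finset (((Fin a × Fin d) × Fin d₀) ⊕ (Fin c × ((Fin a × Fin Q) × Fin d))))
    (hπ : η * c * T.toLeft.card ≤
      ∑ j, ((T.toLeft.image fun x => (π j x).1).card : ℝ))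
    (hρ : ∀ i, η * c * (univ.filter fun y => (i, y) ∈ T.toRight).card ≤
      ∑ j, (((univ.filter fun y => (i, y) ∈ T.toRight).image fun y => (ρ j y).1).card : ℝ)) :
    η' * c * T.card ≤ ∑ j, ((T.image (layerMap d₀ π ρ j)).card : ℝ) := by
  set A := T.toLeft with hA
  set B : Fin c → Finset ((Fin a × Fin Q) × Fin d) :=
    fun i => univ.filter fun y => (i, y) ∈ T.toRight with hB
  have hT : (T.card : ℝ) = A.card + ∑ i, ((B i).card : ℝ) := by
    rw [card_eq_sum_parts T]; push_cast; rfl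
  have h1 : ∀ j, ((A.image fun x => (π j x).1).card : ℝ) +
      (∑ i, (((B i).image fun y => (ρ j y).1).card : ℝ) - (B j).card) ≤
        ((T.image (layerMap d₀ π ρ j)).card : ℝ) := by
    intro j
    have h2 := Nat.cast_le (α := ℝ) |>.2 (le_card_image_layerMap π ρ j T)
    push_cast at h2
    have h3 := Finset.add_sum_erase univ
      (fun i => (((B i).image fun y => (ρ j y).1).card : ℝ)) (mem_univ j)
    have h4 : (((B j).image fun y => (ρ j y).1).card : ℝ) ≤ (B j).card :=
      Nat.cast_le.2 Finset.card_image_le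
    linarith
  have h5 := Finset.sum_le_sum fun j (_ : j ∈ univ) => h1 j
  rw [Finset.sum_add_distrib, Finset.sum_sub_distrib, Finset.sum_comm] at h5
  have h6 := Finset.sum_le_sum fun i (_ : i ∈ univ) => hρ i
  rw [← Finset.mul_sum] at h6
  refine le_trans ?_ h5
  have h7 : (0 : ℝ) ≤ ∑ i, ((B i).card : ℝ) := Finset.sum_nonneg fun _ _ => Nat.cast_nonneg _
  have h8 : (0 : ℝ) ≤ A.card := Nat.cast_nonneg _
  rw [hT]
  nlinarith

end Construction

/-- For all large `a`, the layered graph is an expander with a set of left vertices that meets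
every right neighbourhood in `d₀` vertices or not at all. -/
theorem exists_graphs {δ ε k : ℝ} {d₀ d : ℕ} (hδ : 0 < δ) (hδ1 : δ < 1) (hε : 0 < ε)
    (hk : 1 < k) (hd₀ : 1 ≤ d₀) (hd : d₀ ≤ d)
    (hsum : ∑ j ∈ range d₀, (1 - 1 / k) ^ j = δ * d₀) :
    ∃ c Q a₀ : ℕ, 0 < c ∧ ∀ a, a₀ ≤ a → ∃ φ : Fin c →
      ((Fin a × Fin d) × Fin d₀) ⊕ (Fin c × ((Fin a × Fin Q) × Fin d)) →
      (Fin a × Fin d) ⊕ (Fin c × (Fin a × Fin Q)),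
      (∀ j p, (univ.filter fun u => φ j u = p).card = d ∨
        (univ.filter fun u => φ j u = p).card = 0) ∧
      (∀ j p, (univ.filter fun u => φ j u = p ∧ u ∈ univ.map Function.Embedding.inl).card = d₀ ∨
        (univ.filter fun u => φ j u = p ∧ u ∈ univ.map Function.Embedding.inl).card = 0) ∧
      ∀ T : Finset (((Fin a × Fin d) × Fin d₀) ⊕ (Fin c × ((Fin a × Fin Q) × Fin d))),
        (T.card : ℝ) * k ≤ a * d * d₀ →
        (δ - ε) * c * T.card ≤ ∑ j, ((T.image (φ j)).card : ℝ) := by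
  have hk0 : 0 < k := by linarith
  -- Half of `ε` goes to the random layers and half to the ignored copies; `δ / 2` keeps `η`
  -- positive when `ε` is large.
  set η : ℝ := max (δ - ε / 2) (δ / 2) with hη
  have hη0 : 0 < η := lt_of_lt_of_le (by linarith) (le_max_right _ _)
  have hηδ : η < δ := max_lt (by linarith) (by linarith)
  have hηε : δ - ε / 2 ≤ η := le_max_left _ _
  obtain ⟨c₁, a₁, h₁⟩ := exists_layers hd₀ hk hδ1.le hη0 hηδ hsum.ge
  set k' : ℝ := max 2 (d / (1 - δ)) with hk'
  have hk'2 : 2 ≤ k' := le_max_left _ _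
  obtain ⟨c₂, a₂, h₂⟩ := exists_layers (hd₀.trans hd) (by linarith : 1 < k') hδ1.le hη0 hηδ
    (mul_le_sum_pow hδ1 (by linarith) (le_max_right _ _))
  set c : ℕ := max (max c₁ c₂) (⌈2 / ε⌉₊ + 1) with hc
  -- Makes each filler copy so large that density `1/k` in the first part is at most density `1/k'`
  -- in the copy.
  set Q : ℕ := max d ⌈k' * d₀ / k⌉₊ with hQ
  have hQd : d ≤ Q := le_max_left _ _
  have hQk : k' * d₀ ≤ Q * k := by
    have : k' * d₀ / k ≤ (Q : ℝ) := (Nat.le_ceil _).trans (Nat.cast_le.2 (le_max_right _ _))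
    rwa [div_le_iff₀ hk0] at this
  have hcε : 2 ≤ c * ε := by
    have h : (⌈2 / ε⌉₊ : ℝ) ≤ c :=
      Nat.cast_le.2 ((Nat.le_succ _).trans (le_max_right _ _))
    have := (Nat.le_ceil _).trans h
    rwa [div_le_iff₀ hε] at this
  refine ⟨c, Q, max a₁ a₂, lt_of_lt_of_le (Nat.succ_pos _) (le_max_right _ _), ?_⟩
  intro a ha
  have hd1 : 1 ≤ d := hd₀.trans hd
  obtain ⟨π, hπ⟩ := h₁ c ((le_max_left _ _).trans (le_max_left _ _)) (Fin a × Fin d) (by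
    simp only [Fintype.card_prod, Fintype.card_fin]
    exact ((le_max_left _ _).trans ha).trans (Nat.le_mul_of_pos_right a hd1))
  obtain ⟨ρ, hρ⟩ := h₂ c ((le_max_right _ _).trans (le_max_left _ _)) (Fin a × Fin Q) (by
    simp only [Fintype.card_prod, Fintype.card_fin]
    exact ((le_max_right _ _).trans ha).trans (Nat.le_mul_of_pos_right a (hd1.trans hQd)))
  refine ⟨layerMap d₀ π ρ, card_filter_layerMap π ρ hd hQd, card_filter_layerMap_inl π ρ, ?_⟩
  intro T hT
  have hTsplit := Finset.card_toLeft_add_card_toRight (u := T)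
  refine expansion_layerMap π ρ (η := η) (by nlinarith) T (hπ _ ?_) fun i => hρ _ ?_
  · have h : (T.toLeft.card : ℝ) ≤ T.card := Nat.cast_le.2 (by omega)
    simp only [Fintype.card_prod, Fintype.card_fin]
    push_cast
    exact (mul_le_mul_of_nonneg_right h hk0.le).trans hT
  · have h1 : (univ.filter fun y => (i, y) ∈ T.toRight).card ≤ T.toRight.card :=
      Finset.card_le_card_of_injOn (fun y => (i, y)) (fun y hy => by simpa using hy)
        (fun y _ y' _ h => by simpa using h)
    have h2 : ((univ.filter fun y => (i, y) ∈ T.toRight).card : ℝ) ≤ T.card :=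
      Nat.cast_le.2 (by omega)
    simp only [Fintype.card_prod, Fintype.card_fin]
    push_cast
    refine (mul_le_mul_of_nonneg_right h2 (by linarith)).trans ?_
    refine le_of_mul_le_mul_right ?_ hk0
    calc (T.card : ℝ) * k' * k = (T.card * k) * k' := by ring
      _ ≤ (a * d * d₀) * k' := mul_le_mul_of_nonneg_right hT (by linarith)
      _ = a * d * (k' * d₀) := by ring
      _ ≤ a * d * (Q * k) := mul_le_mul_of_nonneg_left hQk (by positivity)
      _ = _ := by ring

end TannerExpander

/-- A natural number as the value of `minDist` also says that the Tanner code is nonzero, since the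
zero code has value `⊤`. -/
theorem mainTheorem4 (δ ε : ℝ) (d₀ : ℕ) (hδ : 0 < δ) (hδ1 : δ < 1) (hε : 0 < ε)
    (hδd₀ : 1 < δ * (d₀ : ℝ)) :
    -- `k` is the value `f_δ⁻¹(1 / d₀)`: it exists and is unique
    ∃ k : ℝ, 1 < k ∧ TannerExpander.sizeExpansion δ k = 1 / (d₀ : ℝ) ∧
      (∀ k' : ℝ, 1 < k' → TannerExpander.sizeExpansion δ k' = 1 / (d₀ : ℝ) → k' = k) ∧
      ∀ d : ℕ, d₀ ≤ d →
        ∃ (c : ℕ) (α : ℝ), 0 < c ∧ 0 < α ∧ α ≤ 1 ∧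
          {n : ℕ | ∃ (m : ℕ) (E : Finset (Fin n × Fin m)),
            TannerExpander.IsBipartiteExpander E c d α (δ - ε) ∧
            ∀ C₀ : Submodule (ZMod 2) (Fin d → ZMod 2),
              TannerExpander.minDist C₀ = (d₀ : ℕ∞) →
              ∃ σ : TannerExpander.NbrOrdering E d, ∃ D : ℕ,
                TannerExpander.minDist (TannerExpander.tannerCode E σ C₀) = (D : ℕ∞) ∧
                (D : ℝ) ≤ k * α * (n : ℝ)}.Infinite := by
  open TannerExpander in
  have hd₀ : 2 ≤ d₀ := by
    have h : (1 : ℝ) < d₀ := by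
      have := Nat.cast_nonneg (α := ℝ) d₀
      nlinarith
    exact_mod_cast h
  obtain ⟨k, hk, hsum⟩ := exists_sum_pow_eq hδ hδ1 hδd₀
  refine ⟨k, hk, sizeExpansion_eq_of_sum_eq hk hδ1.le (by omega) hsum, ?_, ?_⟩
  · intro k' hk' h
    have hsum' := sum_eq_of_sizeExpansion_eq hk' hδ hδ1.le (by omega) h
    rcases lt_trichotomy k' k with hlt | heq | hlt
    · have := sum_pow_lt_sum_pow hk' hlt hd₀
      linarith
    · exact heq
    · have := sum_pow_lt_sum_pow hk hlt hd₀
      linarith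
  · intro d hd
    obtain ⟨c, Q, a₀, hc, H⟩ := exists_graphs hδ hδ1 hε hk (by omega) hd hsum
    have hk0 : 0 < k := by linarith
    have hd₀0 : (0 : ℝ) < d₀ := by exact_mod_cast (by omega : 0 < d₀)
    have hW : (0 : ℝ) < d₀ + c * Q := by positivity
    -- With `n = a d (d₀ + c Q)`, this `α` makes `k α n = a d d₀`, the size of the codeword support.
    refine ⟨c, d₀ / (k * (d₀ + c * Q)), hc, by positivity, ?_, ?_⟩
    · rw [div_le_one (by positivity)]
      have : (0 : ℝ) ≤ c * Q := by positivity
      nlinarith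
    · refine Set.infinite_of_injective_forall_mem (f := fun a : ℕ => Fintype.card
        (((Fin (a + a₀ + 1) × Fin d) × Fin d₀) ⊕
          (Fin c × ((Fin (a + a₀ + 1) × Fin Q) × Fin d)))) ?_ ?_
      · refine StrictMono.injective (strictMono_nat_of_lt_succ fun a => ?_)
        simp only [Fintype.card_sum, Fintype.card_prod, Fintype.card_fin]
        refine add_lt_add_of_lt_of_le ?_ (by gcongr; omega)
        have : 0 < d * d₀ := Nat.mul_pos (by omega) (by omega)
        rw [mul_assoc, mul_assoc]
        exact Nat.mul_lt_mul_of_pos_right (by omega) this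
      · intro a
        obtain ⟨φ, hfib, hS, hexp⟩ := H (a + a₀ + 1) (by omega)
        have hn : k * (d₀ / (k * (d₀ + c * Q))) * (Fintype.card
            (((Fin (a + a₀ + 1) × Fin d) × Fin d₀) ⊕
              (Fin c × ((Fin (a + a₀ + 1) × Fin Q) × Fin d))) : ℝ) =
            ((a + a₀ + 1 : ℕ) : ℝ) * d * d₀ := by
          simp only [Fintype.card_sum, Fintype.card_prod, Fintype.card_fin, Nat.cast_add,
            Nat.cast_mul]
          field_simp
        obtain ⟨m, E, hE, S, hScard, hSE⟩ := exists_fin_graph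
          (α := d₀ / (k * (d₀ + c * Q))) φ _ hfib hS (by
            intro T hT
            refine hexp T ?_
            rw [← hn, mul_comm (T.card : ℝ) k, mul_assoc]
            exact mul_le_mul_of_nonneg_left hT hk0.le)
        have hSc : S.card = (a + a₀ + 1) * d * d₀ := by rw [hScard]; simp
        refine ⟨m, E, hE, fun C₀ hC₀ => ?_⟩
        obtain ⟨σ, D, hD, hDS⟩ := exists_ordering_minDist_le hE.right_regular
          (Finset.card_pos.1 (by
            rw [hSc]
            exact Nat.mul_pos (Nat.mul_pos (by omega) (by omega)) (by omega))) hSE hC₀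
        refine ⟨σ, D, hD, ?_⟩
        rw [hn]
        rw [hSc] at hDS
        exact_mod_cast hDS
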